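/- Let $\mathcal D$ be a separable complex Hilbert space and let $B$ be a Schur function in $\mathcal S(\mathcal D,\mathbb C)$, that is, an analytic function on the unit disc $\mathbb D$ whose values are contractions $B(z):\mathcal D\to\mathbb C$; thus $B(z)$ is a row vector $(b_1(z),b_2(z),\dots)$, and for row vectors $\beta,\xi$ we write $\beta\xi^*=\sum_i\beta_i\overline{\xi_i}$. Let $\mathcal H(B)$ be the de Branges–Rovnyak space of $B$, i.e. the range of $(I-T_BT_B^*)^{1/2}$ with the Hilbert space structure that makes this operator a coisometry, where $T_B:H^2(\mathcal D)\to H^2$ is multiplication by $B$; its reproducing kernel is $K^B_z(w)=\frac{1-B(w)B(z)^*}{1-w\overline z}$. Let $\lambda\in\mathbb T$. "Non-tangentially" ($\angle\lim$) means inside $\Gamma_\alpha(\lambda)=\{z\in\mathbb D:|z-\lambda|<\alpha(1-|z|)\}$ for each $\alpha>1$. Suppose that $B$ satisfies the Carathéodory condition at $\lambda$: there is a row vector $\xi$ with $\|\xi\|=1$ such that $\angle\lim_{z\to\lambda}(1-B(z)\xi^*)(1-z\overline\lambda)^{-1}$ exists in $\mathbb C$. Then $B$ has a non-tangential limit $B(\lambda)$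 at $\lambda$ (in norm), the function $K^B_\lambda(w)=\frac{1-B(w)B(\lambda)^*}{1-w\overline\lambda}$ belongs to $\mathcal H(B)$, and $K^B_z\to K^B_\lambda$ in the norm of $\mathcal H(B)$ as $z\to\lambda$ non-tangentially. Moreover, the following lower limit (over all $z\in\mathbb D$, $z\to\lambda$) is finite, the following non-tangential limit exists, and $$\liminf_{z\to\lambda}\frac{1-\|B(z)\|}{1-|z|}=\angle\lim_{z\to\lambda}\frac{1-B(z)B(\lambda)^*}{1-z\overline\lambda}.$$ If $B$ is not constant on $\mathbb D$, then moreover $\mu_{B(\lambda)}(\{\lambda\})>0$ and both are equal to $\frac1{\mu_{B(\lambda)}(\{\lambda\})}$. Here $\mu_\xi$ is the Aleksandrov–Clark measure for $B$ associated with $\xi$, the unique finite positive Borel measure on $\mathbb T$ such that $H_\xi(z)=\frac{1+B(z)\xi^*}{1-B(z)\xi^*}$ satisfies $H_\xi(z)=\int_{\mathbb T}\frac{\zeta+z}{\zeta-z}\,d\mu_\xi(\zeta)+i\,\mathrm{Im}\,H_\xi(0)$ for all $z\in\mathbb D$. -/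

import Mathlib

open Filter Topology MeasureTheory Metric
open scoped ComplexConjugate

namespace DeBrangesRovnyak

set_option linter.unusedSectionVars false

variable {D E : Type*} [NormedAddCommGroup D] [InnerProductSpace ℂ D] [CompleteSpace D]
  [NormedAddCommGroup E] [InnerProductSpace ℂ E] [CompleteSpace E]

lemma integral_exp_inner (n m : ℕ) (x y : E) :
    ∫ t in (0:ℝ)..2 * Real.pi, inner ℂ (Complex.exp (n * t * Complex.I) • x)
      (Complex.exp (m * t * Complex.I) • y) =
      if m = n then 2 * Real.pi * inner ℂ x y else 0 := by
  have h1 : ∀ t : ℝ, inner ℂ (Complex.exp (n * t * Complex.I) • x)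
      (Complex.exp (m * t * Complex.I) • y)
      = Complex.exp (((m:ℂ) - n) * Complex.I * t) * inner ℂ x y := by
    intro t
    rw [inner_smul_left, inner_smul_right, ← mul_assoc, ← Complex.exp_conj, ← Complex.exp_add]
    congr 2
    simp
    ring
  simp_rw [h1]
  rw [intervalIntegral.integral_mul_const]
  split_ifs with h
  · subst h; simp
  · rw [integral_exp_mul_complex]
    · have : ((m:ℂ) - n) * Complex.I * ((2 * Real.pi : ℝ) : ℂ)
          = ((m - n : ℤ) : ℂ) * (2 * Real.pi * Complex.I) := by push_cast; ring
      rw [this, Complex.exp_int_mul_two_pi_mul_I]; simp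
    · refine mul_ne_zero (sub_ne_zero.2 ?_) Complex.I_ne_zero
      exact_mod_cast h

lemma hasSum_integral_inner {g : ℕ → E} (hg : Summable fun n => ‖g n‖) (F : ℝ → E)
    (hF : Continuous F) :
    HasSum (fun n : ℕ => ∫ t in (0:ℝ)..2 * Real.pi,
      inner ℂ (F t) (Complex.exp (n * t * Complex.I) • g n))
      (∫ t in (0:ℝ)..2 * Real.pi, inner ℂ (F t) (∑' n : ℕ, Complex.exp (n * t * Complex.I) • g n)) := by
  have hnorm : ∀ (n : ℕ) (t : ℝ), ‖Complex.exp (n * t * Complex.I) • g n‖ = ‖g n‖ := by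
    intro n t
    rw [norm_smul]
    have : ((n:ℂ) * t * Complex.I) = ((n * t : ℝ) : ℂ) * Complex.I := by push_cast; ring
    rw [this, Complex.norm_exp_ofReal_mul_I, one_mul]
  obtain ⟨C, hC⟩ := (isCompact_uIcc (a := (0:ℝ)) (b := 2 * Real.pi)).exists_bound_of_continuousOn
    hF.continuousOn
  have hsum : ∀ t : ℝ, Summable fun n : ℕ => Complex.exp (n * t * Complex.I) • g n := fun t =>
    Summable.of_norm (by simpa only [hnorm] using hg)
  refine intervalIntegral.hasSum_integral_of_dominated_convergence
    (fun n _ => C * ‖g n‖) ?_ ?_ ?_ ?_ ?_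
  · intro n
    exact Continuous.aestronglyMeasurable (by fun_prop)
  · intro n
    refine Eventually.of_forall fun t ht => ?_
    refine (norm_inner_le_norm _ _).trans ?_
    rw [hnorm]
    exact mul_le_mul_of_nonneg_right (hC t (Set.uIoc_subset_uIcc ht)) (norm_nonneg _)
  · exact Eventually.of_forall fun t _ => hg.mul_left C
  · simp
  · refine Eventually.of_forall fun t _ => ?_
    exact (hsum t).hasSum.mapL (innerSL ℂ (F t))

lemma continuous_tsum_exp {g : ℕ → E} (hg : Summable fun n => ‖g n‖) :
    Continuous fun t : ℝ => ∑' n : ℕ, Complex.exp (n * t * Complex.I) • g n := by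
  refine continuous_tsum (fun n => by fun_prop) hg fun n t => ?_
  rw [norm_smul]
  have : ((n:ℂ) * t * Complex.I) = ((n * t : ℝ) : ℂ) * Complex.I := by push_cast; ring
  rw [this, Complex.norm_exp_ofReal_mul_I, one_mul]

/-- Parseval's identity for absolutely convergent vector-valued Fourier series. -/
lemma parseval {g : ℕ → E} (hg : Summable fun n => ‖g n‖) :
    HasSum (fun n => 2 * Real.pi * ‖g n‖ ^ 2)
      (∫ t in (0:ℝ)..2 * Real.pi, ‖∑' n : ℕ, Complex.exp (n * t * Complex.I) • g n‖ ^ 2) := by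
  have h1 := hasSum_integral_inner hg _ (continuous_tsum_exp hg)
  have h2 : ∀ n : ℕ, ∫ t in (0:ℝ)..2 * Real.pi,
      inner ℂ (∑' n : ℕ, Complex.exp (n * t * Complex.I) • g n)
        (Complex.exp (n * t * Complex.I) • g n) = ((2 * Real.pi * ‖g n‖ ^ 2 : ℝ) : ℂ) := by
    intro n
    have h3 := (hasSum_integral_inner hg (fun t => Complex.exp (n * t * Complex.I) • g n)
      (by fun_prop)).tsum_eq
    simp_rw [integral_exp_inner] at h3
    rw [tsum_ite_eq] at h3
    have h4 := congrArg (starRingEnd ℂ) h3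
    have hconj : ∀ f : ℝ → ℂ, starRingEnd ℂ (∫ t in (0:ℝ)..2 * Real.pi, f t) =
        ∫ t in (0:ℝ)..2 * Real.pi, starRingEnd ℂ (f t) := by
      intro f
      simp only [intervalIntegral, map_sub, integral_conj]
    rw [hconj] at h4
    simp_rw [inner_conj_symm] at h4
    rw [← h4, map_mul, inner_conj_symm, inner_self_eq_norm_sq_to_K]
    simp only [map_mul, Complex.conj_ofReal, Complex.ofReal_mul, Complex.ofReal_pow]
    rw [show (starRingEnd ℂ) 2 = 2 from map_ofNat _ 2]
    simp
  simp_rw [h2] at h1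
  have h5 : ∀ t : ℝ, inner ℂ (∑' n : ℕ, Complex.exp (n * t * Complex.I) • g n)
      (∑' n : ℕ, Complex.exp (n * t * Complex.I) • g n) =
      ((‖∑' n : ℕ, Complex.exp (n * t * Complex.I) • g n‖ ^ 2 : ℝ) : ℂ) := by
    intro t; rw [inner_self_eq_norm_sq_to_K]; simp
  simp_rw [h5] at h1
  rw [intervalIntegral.integral_ofReal] at h1
  exact_mod_cast h1

lemma summable_norm_pow {c : ℕ → E} {F : ℂ → E}
    (h : ∀ z ∈ ball (0 : ℂ) 1, HasSum (fun n => z ^ n • c n) (F z)) {r : ℝ} (hr0 : 0 ≤ r)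
    (hr1 : r < 1) : Summable fun n => ‖((r : ℂ) ^ n) • c n‖ := by
  obtain ⟨s, hrs, hs1⟩ := exists_between hr1
  have hs0 : 0 < s := hr0.trans_lt hrs
  have hs := h (s : ℂ) (by simpa [abs_of_pos hs0] using hs1)
  have hlim := hs.summable.tendsto_atTop_zero.norm
  have hq : r / s < 1 := (div_lt_one hs0).2 hrs
  refine summable_of_isBigO_nat (summable_geometric_of_lt_one (by positivity) hq) ?_
  refine Asymptotics.IsBigO.of_bound 1 ?_
  rw [norm_zero] at hlim
  have := hlim.eventually (Iic_mem_nhds zero_lt_one)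
  filter_upwards [this] with n hn
  rw [norm_norm, one_mul, norm_smul, norm_pow, Complex.norm_real, Real.norm_of_nonneg hr0,
    Real.norm_of_nonneg (by positivity), div_pow, le_div_iff₀ (by positivity)]
  rw [norm_smul, norm_pow, Complex.norm_real, Real.norm_of_nonneg hs0.le] at hn
  calc r ^ n * ‖c n‖ * s ^ n = r ^ n * (s ^ n * ‖c n‖) := by ring
    _ ≤ r ^ n * 1 := by gcongr
    _ = r ^ n := mul_one _

lemma mem_ball_circle {r : ℝ} (hr0 : 0 ≤ r) (hr1 : r < 1) (t : ℝ) :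
    (r : ℂ) * Complex.exp (t * Complex.I) ∈ ball (0 : ℂ) 1 := by
  rw [mem_ball_zero_iff, norm_mul, Complex.norm_exp_ofReal_mul_I, Complex.norm_real,
    Real.norm_of_nonneg hr0, mul_one]
  exact hr1

lemma parseval_radius {c : ℕ → E} {F : ℂ → E}
    (h : ∀ z ∈ ball (0 : ℂ) 1, HasSum (fun n => z ^ n • c n) (F z)) {r : ℝ} (hr0 : 0 ≤ r)
    (hr1 : r < 1) :
    HasSum (fun n => 2 * Real.pi * (r ^ n * ‖c n‖) ^ 2)
      (∫ t in (0:ℝ)..2 * Real.pi, ‖F (r * Complex.exp (t * Complex.I))‖ ^ 2) := by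
  have h1 := parseval (summable_norm_pow h hr0 hr1)
  simp only [norm_smul, norm_pow, Complex.norm_real, Real.norm_of_nonneg hr0] at h1
  convert! h1 using 3 with t
  rw [← (h _ (mem_ball_circle hr0 hr1 t)).tsum_eq]
  congr 2
  refine tsum_congr fun n => ?_
  rw [smul_smul, mul_pow, ← Complex.exp_nat_mul, mul_comm, mul_assoc]

lemma coeff_unique {a b : ℕ → E} {F : ℂ → E}
    (ha : ∀ z ∈ ball (0 : ℂ) 1, HasSum (fun n => z ^ n • a n) (F z))
    (hb : ∀ z ∈ ball (0 : ℂ) 1, HasSum (fun n => z ^ n • b n) (F z)) : a = b := by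
  have h : ∀ z ∈ ball (0 : ℂ) 1, HasSum (fun n => z ^ n • (a n - b n)) ((fun _ => (0 : E)) z) := by
    intro z hz
    simpa [smul_sub] using (ha z hz).sub (hb z hz)
  have h1 := parseval_radius h (r := 1 / 2) (by norm_num) (by norm_num)
  simp only [norm_zero, ne_eq, OfNat.ofNat_ne_zero, not_false_eq_true, zero_pow,
    intervalIntegral.integral_zero] at h1
  rw [hasSum_zero_iff_of_nonneg (fun n => by positivity)] at h1
  funext n
  have h2 := congrFun h1 n
  simp only [Pi.zero_apply] at h2
  have h3 : ‖a n - b n‖ = 0 := by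
    by_contra hne
    have : 0 < ‖a n - b n‖ := lt_of_le_of_ne (norm_nonneg _) (Ne.symm hne)
    have : 0 < 2 * Real.pi * ((1 / 2) ^ n * ‖a n - b n‖) ^ 2 := by positivity
    exact this.ne' h2
  exact sub_eq_zero.1 (norm_eq_zero.1 h3)

variable (E) in
/-- The Hardy space `H²(E)` of square summable power series with coefficients in `E`, given by the
sequence of coefficients, with its Hilbert space structure. -/
abbrev Hardy : Type _ := lp (fun _ : ℕ => E) 2

/-- The value at `z` of the power series `∑ f_n z^n`. -/
noncomputable def Hardy.eval (f : Hardy E) (z : ℂ) : E := ∑' n : ℕ, z ^ n • f n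

lemma Hardy.norm_coeff_le (f : Hardy E) (n : ℕ) : ‖f n‖ ≤ ‖f‖ :=
  lp.norm_apply_le_norm (by norm_num) f n

lemma Hardy.hasSum_eval (f : Hardy E) {z : ℂ} (hz : z ∈ ball (0 : ℂ) 1) :
    HasSum (fun n : ℕ => z ^ n • f n) (f.eval z) := by
  refine Summable.hasSum (Summable.of_norm_bounded (g := fun n => ‖z‖ ^ n * ‖f‖) ?_ fun n => ?_)
  · exact (summable_geometric_of_lt_one (norm_nonneg z) (by simpa using hz)).mul_right _
  · rw [norm_smul, norm_pow]
    gcongr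
    exact f.norm_coeff_le n

lemma Hardy.eval_injective {f g : Hardy E}
    (h : ∀ z ∈ ball (0 : ℂ) 1, f.eval z = g.eval z) : f = g :=
  lp.ext (coeff_unique (F := f.eval) (fun _ hz => f.hasSum_eval hz)
    fun z hz => by rw [h z hz]; exact g.hasSum_eval hz)

lemma Hardy.eval_add (f g : Hardy E) {z : ℂ} (hz : z ∈ ball (0 : ℂ) 1) :
    (f + g).eval z = f.eval z + g.eval z := by
  refine ((f + g).hasSum_eval hz).unique ?_
  simpa [smul_add] using (f.hasSum_eval hz).add (g.hasSum_eval hz)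

lemma Hardy.eval_smul (a : ℂ) (f : Hardy E) {z : ℂ} (hz : z ∈ ball (0 : ℂ) 1) :
    (a • f).eval z = a • f.eval z := by
  refine ((a • f).hasSum_eval hz).unique ?_
  simp_rw [lp.coeFn_smul, Pi.smul_apply, smul_comm _ a]
  exact (f.hasSum_eval hz).const_smul a

lemma Hardy.differentiableOn_eval (f : Hardy E) :
    DifferentiableOn ℂ f.eval (ball (0 : ℂ) 1) := by
  intro z hz
  obtain ⟨r, hzr, hr1⟩ := exists_between (mem_ball_zero_iff.1 hz)
  have hr0 : 0 ≤ r := (norm_nonneg z).trans hzr.le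
  have h := Complex.differentiableOn_tsum_of_summable_norm (F := fun (n : ℕ) (z : ℂ) => z ^ n • f n)
    (u := fun n => r ^ n * ‖f‖) (U := ball (0 : ℂ) r)
    ((summable_geometric_of_lt_one hr0 hr1).mul_right _) (fun n => by fun_prop) isOpen_ball
    (fun n w hw => by
      rw [norm_smul, norm_pow]
      have : ‖w‖ ≤ r := (mem_ball_zero_iff.1 hw).le
      gcongr
      exact f.norm_coeff_le n)
  exact (h.differentiableAt (isOpen_ball.mem_nhds (by simpa using hzr))).differentiableWithinAt

variable (D E) in
/-- The Schur class `S(D, E)`: analytic functions on the unit disc whose values are contractions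
from `D` to `E`. Values outside the disc play no role. -/
structure SchurFunction where
  toFun : ℂ → D →L[ℂ] E
  differentiableOn : DifferentiableOn ℂ toFun (ball (0 : ℂ) 1)
  norm_le_one : ∀ z ∈ ball (0 : ℂ) 1, ‖toFun z‖ ≤ 1

instance : CoeFun (SchurFunction D E) (fun _ => ℂ → D →L[ℂ] E) := ⟨SchurFunction.toFun⟩

lemma SchurFunction.exists_mul (B : SchurFunction D E) (f : Hardy D) :
    ∃ g : Hardy E, ‖g‖ ≤ ‖f‖ ∧ ∀ z ∈ ball (0 : ℂ) 1, g.eval z = B z (f.eval z) := by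
  have hF : DifferentiableOn ℂ (fun z => B z (f.eval z)) (ball (0 : ℂ) 1) :=
    B.differentiableOn.clm_apply f.differentiableOn_eval
  set c : ℕ → E := fun n => ((n.factorial : ℂ)⁻¹) • iteratedDeriv n (fun z => B z (f.eval z)) 0
    with hc
  have hsum : ∀ z ∈ ball (0 : ℂ) 1, HasSum (fun n => z ^ n • c n) (B z (f.eval z)) := by
    intro z hz
    have h := Complex.hasSum_taylorSeries_on_ball hF hz
    simp_rw [hc, smul_comm (z ^ _)]
    simpa only [sub_zero] using h
  have hcont : ∀ {G : ℂ → E}, DifferentiableOn ℂ G (ball (0 : ℂ) 1) → ∀ r : ℝ, 0 ≤ r → r < 1 →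
      Continuous fun t : ℝ => ‖G (r * Complex.exp (t * Complex.I))‖ ^ 2 := by
    intro G hG r hr0 hr1
    have : Continuous fun t : ℝ => G (r * Complex.exp (t * Complex.I)) :=
      hG.continuousOn.comp_continuous (by fun_prop) (mem_ball_circle hr0 hr1)
    exact this.norm.pow 2
  have hcontD : ∀ {G : ℂ → D}, DifferentiableOn ℂ G (ball (0 : ℂ) 1) → ∀ r : ℝ, 0 ≤ r → r < 1 →
      Continuous fun t : ℝ => ‖G (r * Complex.exp (t * Complex.I))‖ ^ 2 := by
    intro G hG r hr0 hr1
    have : Continuous fun t : ℝ => G (r * Complex.exp (t * Complex.I)) :=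
      hG.continuousOn.comp_continuous (by fun_prop) (mem_ball_circle hr0 hr1)
    exact this.norm.pow 2
  have hnormf : HasSum (fun n => ‖f n‖ ^ 2) (‖f‖ ^ 2) := by
    simpa using lp.hasSum_norm (p := 2) (by norm_num) f
  have hrad : ∀ (s : Finset ℕ) (r : ℝ), 0 ≤ r → r < 1 →
      ∑ n ∈ s, (r ^ n * ‖c n‖) ^ 2 ≤ ‖f‖ ^ 2 := by
    intro s r hr0 hr1
    have h1 := parseval_radius hsum hr0 hr1
    have h2 := parseval_radius (fun z hz => f.hasSum_eval hz) hr0 hr1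
    have h3 : ∫ t in (0:ℝ)..2 * Real.pi,
          ‖B (r * Complex.exp (t * Complex.I)) (f.eval (r * Complex.exp (t * Complex.I)))‖ ^ 2 ≤
        ∫ t in (0:ℝ)..2 * Real.pi, ‖f.eval (r * Complex.exp (t * Complex.I))‖ ^ 2 := by
      refine intervalIntegral.integral_mono_on (by positivity)
        ((hcont hF r hr0 hr1).intervalIntegrable _ _)
        ((hcontD f.differentiableOn_eval r hr0 hr1).intervalIntegrable _ _) fun t _ => ?_
      have h4 := (B _).le_of_opNorm_le (B.norm_le_one _ (mem_ball_circle hr0 hr1 t))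
        (f.eval (r * Complex.exp (t * Complex.I)))
      rw [one_mul] at h4
      gcongr
    have h5 : ∫ t in (0:ℝ)..2 * Real.pi, ‖f.eval (r * Complex.exp (t * Complex.I))‖ ^ 2 ≤
        2 * Real.pi * ‖f‖ ^ 2 := by
      refine hasSum_le (fun n => ?_) h2 (hnormf.mul_left (2 * Real.pi))
      have : r ^ n * ‖f n‖ ≤ ‖f n‖ :=
        mul_le_of_le_one_left (norm_nonneg _) (pow_le_one₀ hr0 hr1.le)
      gcongr
    have h6 := (sum_le_hasSum s (fun n _ => by positivity) h1).trans (h3.trans h5)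
    rw [← Finset.mul_sum] at h6
    exact le_of_mul_le_mul_left h6 (by positivity)
  have hfin : ∀ s : Finset ℕ, ∑ n ∈ s, ‖c n‖ ^ 2 ≤ ‖f‖ ^ 2 := by
    intro s
    have hlim : Tendsto (fun r : ℝ => ∑ n ∈ s, (r ^ n * ‖c n‖) ^ 2) (𝓝[<] 1)
        (𝓝 (∑ n ∈ s, ((1 : ℝ) ^ n * ‖c n‖) ^ 2)) :=
      ((by fun_prop : Continuous fun r : ℝ => ∑ n ∈ s, (r ^ n * ‖c n‖) ^ 2).tendsto 1).mono_left
        nhdsWithin_le_nhds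
    have h := le_of_tendsto hlim (b := ‖f‖ ^ 2) (by
      filter_upwards [Ioo_mem_nhdsLT (zero_lt_one (α := ℝ))] with r hr
      exact hrad s r hr.1.le hr.2)
    simpa using h
  have hmem : Memℓp c 2 := memℓp_gen' (C := ‖f‖ ^ 2) (by simpa using hfin)
  refine ⟨⟨c, hmem⟩, ?_, fun z hz => (hsum z hz).tsum_eq⟩
  refine lp.norm_le_of_forall_sum_le (p := 2) (by norm_num) (norm_nonneg f) ?_
  simpa using hfin

/-- The multiplication operator `T_B : H²(D) → H²(E)`, `(T_B f)(z) = B(z) f(z)`. -/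
noncomputable def SchurFunction.mulOp (B : SchurFunction D E) : Hardy D →L[ℂ] Hardy E :=
  LinearMap.mkContinuous
    { toFun := fun f => (B.exists_mul f).choose
      map_add' := fun f g => Hardy.eval_injective fun z hz => by
        rw [Hardy.eval_add _ _ hz, (B.exists_mul _).choose_spec.2 z hz,
          (B.exists_mul _).choose_spec.2 z hz, (B.exists_mul _).choose_spec.2 z hz,
          Hardy.eval_add _ _ hz, map_add]
      map_smul' := fun a f => Hardy.eval_injective fun z hz => by
        rw [RingHom.id_apply, Hardy.eval_smul _ _ hz, (B.exists_mul _).choose_spec.2 z hz,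
          (B.exists_mul _).choose_spec.2 z hz, Hardy.eval_smul _ _ hz, map_smul] }
    1 fun f => by rw [one_mul]; exact (B.exists_mul f).choose_spec.1

lemma SchurFunction.eval_mulOp (B : SchurFunction D E) (f : Hardy D) {z : ℂ}
    (hz : z ∈ ball (0 : ℂ) 1) : (B.mulOp f).eval z = B z (f.eval z) :=
  (B.exists_mul f).choose_spec.2 z hz

lemma SchurFunction.norm_mulOp_le (B : SchurFunction D E) : ‖B.mulOp‖ ≤ 1 :=
  LinearMap.mkContinuous_norm_le _ zero_le_one _

section OperatorRange

variable {H K : Type*} [NormedAddCommGroup H] [InnerProductSpace ℂ H] [CompleteSpace H]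
  [NormedAddCommGroup K] [InnerProductSpace ℂ K] [CompleteSpace K]

/-- The operator range `M(A)`: the range of `A`, with the Hilbert space structure below that makes
`A` a coisometry onto it. This norm is in general not the one inherited from `K`. -/
def OperatorRange (A : H →L[ℂ] K) : Type _ := LinearMap.range (A : H →ₗ[ℂ] K)

namespace OperatorRange

variable (A : H →L[ℂ] K)

noncomputable instance : AddCommGroup (OperatorRange A) :=
  inferInstanceAs (AddCommGroup (LinearMap.range (A : H →ₗ[ℂ] K)))

noncomputable instance : Module ℂ (OperatorRange A) :=
  inferInstanceAs (Module ℂ (LinearMap.range (A : H →ₗ[ℂ] K)))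

/-- The inclusion of `M(A)` in `K`. -/
noncomputable def incl : OperatorRange A →ₗ[ℂ] K :=
  (LinearMap.range (A : H →ₗ[ℂ] K)).subtype

/-- `A` restricts to a linear bijection of `(ker A)ᗮ` onto its range. -/
noncomputable def equiv : (LinearMap.ker (A : H →ₗ[ℂ] K))ᗮ ≃ₗ[ℂ] OperatorRange A :=
  haveI : CompleteSpace (LinearMap.ker (A : H →ₗ[ℂ] K)) := A.isClosed_ker.completeSpace_coe
  LinearMap.kerComplementEquivRange (A : H →ₗ[ℂ] K)
    (Submodule.isCompl_orthogonal
      (K := LinearMap.ker (A : H →ₗ[ℂ] K))).symm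

lemma incl_equiv (x : (LinearMap.ker (A : H →ₗ[ℂ] K))ᗮ) : incl A (equiv A x) = A x := rfl

/-- The norm of `M(A)` is transported from `(ker A)ᗮ`. -/
noncomputable instance : NormedAddCommGroup (OperatorRange A) :=
  NormedAddCommGroup.induced (OperatorRange A) (LinearMap.ker (A : H →ₗ[ℂ] K))ᗮ
    (equiv A).symm (equiv A).symm.injective

lemma norm_def (f : OperatorRange A) : ‖f‖ = ‖(equiv A).symm f‖ := rfl

/-- The inner product of `M(A)` is transported from `(ker A)ᗮ`. -/
noncomputable instance : InnerProductSpace ℂ (OperatorRange A) where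
  norm_smul_le a f := by rw [norm_def, norm_def, map_smul, norm_smul]
  inner f g := inner ℂ ((equiv A).symm f) ((equiv A).symm g)
  norm_sq_eq_re_inner f := by rw [norm_def]; exact norm_sq_eq_re_inner _
  conj_inner_symm f g := inner_conj_symm _ _
  add_left f g h := by rw [map_add, inner_add_left]
  smul_left f g a := by rw [map_smul, inner_smul_left]

/-- `A` maps `(ker A)ᗮ` isometrically onto `M(A)`. -/
noncomputable def isometryEquiv : (LinearMap.ker (A : H →ₗ[ℂ] K))ᗮ ≃ₗᵢ[ℂ] OperatorRange A :=
  ⟨equiv A, fun x => by rw [norm_def, LinearEquiv.symm_apply_apply]⟩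

instance : CompleteSpace (OperatorRange A) :=
  (isometryEquiv A).symm.toIsometryEquiv.completeSpace

end OperatorRange

/-- The defect operator `D_{A^*} = (I - A A^*)^{1/2}`, by the continuous functional calculus. -/
noncomputable def defectOp (A : H →L[ℂ] K) : K →L[ℂ] K :=
  CFC.sqrt (1 - A ∘L ContinuousLinearMap.adjoint A)

lemma isPositive_defectOp (A : H →L[ℂ] K) : (defectOp A).IsPositive :=
  (ContinuousLinearMap.nonneg_iff_isPositive _).1 (CFC.sqrt_nonneg _)

lemma defectOp_mul_self (A : H →L[ℂ] K) (hA : ‖A‖ ≤ 1) :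
    defectOp A * defectOp A = 1 - A ∘L ContinuousLinearMap.adjoint A := by
  refine CFC.sqrt_mul_sqrt_self _ ?_
  rw [ContinuousLinearMap.nonneg_iff_isPositive, ContinuousLinearMap.isPositive_iff_complex]
  intro x
  have h : inner ℂ ((1 - A ∘L ContinuousLinearMap.adjoint A) x) x =
      ((‖x‖ ^ 2 - ‖ContinuousLinearMap.adjoint A x‖ ^ 2 : ℝ) : ℂ) := by
    simp only [sub_apply, one_apply_eq_self, ContinuousLinearMap.comp_apply, inner_sub_left]
    rw [← ContinuousLinearMap.adjoint_inner_right, inner_self_eq_norm_sq_to_K,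
      inner_self_eq_norm_sq_to_K]
    simp
  rw [h]
  refine ⟨by rw [RCLike.re_to_complex, Complex.ofReal_re], ?_⟩
  rw [RCLike.re_to_complex, Complex.ofReal_re, sub_nonneg]
  have := (ContinuousLinearMap.adjoint A).le_of_opNorm_le (c := 1)
    (by rw [LinearIsometryEquiv.norm_map]; exact hA) x
  rw [one_mul] at this
  gcongr

/-- The de Branges-Rovnyak space `H(A) = M(D_{A^*})` of a contraction `A`. -/
abbrev DBRSpace (A : H →L[ℂ] K) : Type _ := OperatorRange (defectOp A)

end OperatorRange

/-- The de Branges-Rovnyak space `H(B) = H(T_B)` of a Schur function `B`. -/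
abbrev SchurFunction.Space (B : SchurFunction D E) : Type _ := DBRSpace B.mulOp

/-- The value at `z` of a function in `H(B) ⊆ H²(E)`. -/
noncomputable def SchurFunction.Space.eval {B : SchurFunction D E} (f : B.Space) (z : ℂ) : E :=
  Hardy.eval (OperatorRange.incl _ f) z

/-- `β ξ^*` for row vectors `β, ξ : D → ℂ`. If `β_i`, `ξ_i` are their entries with respect to an
orthonormal basis of `D`, this is `∑ β_i conj(ξ_i)`. -/
noncomputable def mulStar (β ξ : D →L[ℂ] ℂ) : ℂ := β (ContinuousLinearMap.adjoint ξ 1)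

/-- The non-tangential approach region `Γ_α(λ)`. -/
def approachRegion (lam : ℂ) (α : ℝ) : Set ℂ := {z | ‖z‖ < 1 ∧ ‖z - lam‖ < α * (1 - ‖z‖)}

/-- `z → λ` non-tangentially: `Tendsto f (nontangential λ) l` says that `f` tends to `l` along
`Γ_α(λ)` for each `α > 1`. -/
noncomputable def nontangential (lam : ℂ) : Filter ℂ :=
  ⨆ α ∈ Set.Ioi (1 : ℝ), 𝓝[approachRegion lam α] lam

/-- The Carathéodory condition for `B` at `λ`. -/
def SatisfiesCaratheodory (B : SchurFunction D ℂ) (lam : sphere (0 : ℂ) 1) : Prop :=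
  ∃ ξ : D →L[ℂ] ℂ, ‖ξ‖ = 1 ∧ ∃ l : ℂ,
    Tendsto (fun z => (1 - mulStar (B z) ξ) * (1 - z * conj (lam : ℂ))⁻¹)
      (nontangential lam) (𝓝 l)

/-- `H_ξ = (1 + B ξ^*) / (1 - B ξ^*)`. -/
noncomputable def clarkFunction (B : SchurFunction D ℂ) (ξ : D →L[ℂ] ℂ) (z : ℂ) : ℂ :=
  (1 + mulStar (B z) ξ) / (1 - mulStar (B z) ξ)

/-- `μ` is a finite positive Borel measure on the unit circle that represents `H_ξ` by the
Herglotz formula. -/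
def IsClarkMeasure (B : SchurFunction D ℂ) (ξ : D →L[ℂ] ℂ) (μ : Measure (sphere (0 : ℂ) 1)) :
    Prop :=
  IsFiniteMeasure μ ∧ ∀ z ∈ ball (0 : ℂ) 1,
    clarkFunction B ξ z =
      ∫ ζ : sphere (0 : ℂ) 1, ((ζ : ℂ) + z) / ((ζ : ℂ) - z) ∂μ +
        Complex.I * ((clarkFunction B ξ 0).im : ℂ)

open Classical in
/-- The Aleksandrov-Clark measure `μ_ξ` for `B` associated with `ξ`. It exists and is unique
if `‖ξ‖ ≤ 1`, unless `B ξ^*` is constantly `1`; then `H_ξ` is not defined. -/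
noncomputable def clarkMeasure (B : SchurFunction D ℂ) (ξ : D →L[ℂ] ℂ) :
    Measure (sphere (0 : ℂ) 1) :=
  if h : ∃ μ, IsClarkMeasure B ξ μ then h.choose else 0

end DeBrangesRovnyak

/-! The geometry of `H(B)` carries the proof: its kernels satisfy ‖K_z‖² = (1 - ‖B(z)‖²)/(1 - |z|²).
The Carathéodory condition, with limit l, forces B(z)ξ* → 1; since ‖B(z)‖ ≤ 1 = ‖ξ‖, near-equality
in Cauchy–Schwarz gives B(z) → ξ in norm, so B(λ) = ξ.

The condition also bounds K_{rλ} as r → 1. A weak limit g is the boundary kernel (1 - B(w)ξ*)/(1 - w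
conj λ), and l = lim g(rλ) = ⟨g, g⟩, so l = ‖g‖² is real and nonnegative (`exists_boundary_kernel`).
Expanding ‖K_z - g‖² = ‖K_z‖² - 2 Re g(z) + ‖g‖² then gives norm convergence, because ‖K_z‖² is
asymptotically at most l (`IsKernel.tendsto_boundary_kernel`).

Non-tangentially (1 - ‖B(z)‖)/(1 - |z|) → l, so the lower limit is at most l. For the reverse bound
z may approach λ tangentially. If the quotient is frequently below a, Cauchy–Schwarz for K_z and
K_w, in the limit z → λ, bounds the kernel built on a weak-* limit β of B(z); letting w → λ
non-tangentially shows first β = ξ and then l² ≤ l a (`IsKernel.norm_sq_le_of_frequently`).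

Finally (1 - r) H_ξ(rλ) → 2 μ_ξ({λ}) by dominated convergence, while its product with the
Carathéodory quotient is 1 + B(rλ)ξ* → 2. Hence l μ_ξ({λ}) = 1. -/

namespace DeBrangesRovnyak

/-! ### Szegő kernels and the reproducing kernel of `H(B)` -/

section Kernels

variable {D E : Type*} [NormedAddCommGroup D] [InnerProductSpace ℂ D]
  [NormedAddCommGroup E] [InnerProductSpace ℂ E]

lemma memℓp_szego {z : ℂ} (hz : z ∈ ball (0 : ℂ) 1) (e : E) :
    Memℓp (fun n : ℕ => conj z ^ n • e) 2 := by
  refine memℓp_gen ?_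
  have h1 : ‖z‖ < 1 := by simpa using hz
  have h : Summable fun n : ℕ => (‖z‖ ^ 2) ^ n * ‖e‖ ^ 2 :=
    (summable_geometric_of_lt_one (by positivity)
      (pow_lt_one₀ (norm_nonneg z) h1 two_ne_zero)).mul_right _
  refine h.congr fun n => ?_
  rw [norm_smul, norm_pow, RCLike.norm_conj, ENNReal.toReal_ofNat, Real.rpow_ofNat]
  ring

open Classical in
/-- The Szegő kernel `e / (1 - w conj z)` of `H²(E)` at a point `z` of the disc; zero elsewhere. -/
noncomputable def szego (z : ℂ) (e : E) : Hardy E :=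
  if hz : z ∈ ball (0 : ℂ) 1 then ⟨fun n => conj z ^ n • e, memℓp_szego hz e⟩ else 0

lemma szego_apply {z : ℂ} (hz : z ∈ ball (0 : ℂ) 1) (e : E) (n : ℕ) :
    szego z e n = conj z ^ n • e := by
  rw [szego, dif_pos hz]

variable [CompleteSpace D] [CompleteSpace E]

lemma inner_szego {z : ℂ} (hz : z ∈ ball (0 : ℂ) 1) (e : E) (f : Hardy E) :
    inner ℂ (szego z e) f = inner ℂ e (f.eval z) := by
  refine (lp.hasSum_inner (szego z e) f).unique ?_
  have h := (f.hasSum_eval hz).mapL (innerSL ℂ e)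
  simp only [innerSL_apply_apply, inner_smul_right] at h
  simpa [szego_apply hz, inner_smul_left] using h

lemma mul_conj_ne_one {z w : ℂ} (hz : ‖z‖ ≤ 1) (hw : w ∈ ball (0 : ℂ) 1) :
    1 - w * conj z ≠ 0 := by
  intro h
  have h1 : ‖w * conj z‖ = 1 := by rw [← sub_eq_zero.1 h, norm_one]
  rw [norm_mul, RCLike.norm_conj] at h1
  have h2 : ‖w‖ < 1 := by simpa using hw
  nlinarith [norm_nonneg w, norm_nonneg z]

lemma eval_szego {z w : ℂ} (hz : z ∈ ball (0 : ℂ) 1) (hw : w ∈ ball (0 : ℂ) 1) (e : E) :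
    (szego z e).eval w = (1 - w * conj z)⁻¹ • e := by
  refine ((szego z e).hasSum_eval hw).unique ?_
  have h1 : ‖w * conj z‖ < 1 := by
    rw [norm_mul, RCLike.norm_conj]
    have h2 : ‖w‖ < 1 := by simpa using hw
    have h3 : ‖z‖ < 1 := by simpa using hz
    nlinarith [norm_nonneg w, norm_nonneg z]
  simp_rw [szego_apply hz, smul_smul, ← mul_pow]
  exact (hasSum_geometric_of_norm_lt_one h1).smul_const e

/-- Pairing either side with f gives ⟨e, B(z) f(z)⟩. This is what makes the kernel of `H(B)`
explicit. -/
lemma adjoint_mulOp_szego (B : SchurFunction D E) {z : ℂ} (hz : z ∈ ball (0 : ℂ) 1) (e : E) :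
    ContinuousLinearMap.adjoint B.mulOp (szego z e) =
      szego z (ContinuousLinearMap.adjoint (B z) e) := by
  refine ext_inner_right ℂ fun f => ?_
  rw [ContinuousLinearMap.adjoint_inner_left, inner_szego hz, inner_szego hz,
    B.eval_mulOp f hz, ContinuousLinearMap.adjoint_inner_left]

section OperatorRange

variable {H K : Type*} [NormedAddCommGroup H] [InnerProductSpace ℂ H] [CompleteSpace H]
  [NormedAddCommGroup K] [InnerProductSpace ℂ K] [CompleteSpace K]

/-- The inclusion of `M(A)` has adjoint `A A^*`, considered as a map into `M(A)`. -/
lemma OperatorRange.exists_inner_eq (A : H →L[ℂ] K) (k : K) :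
    ∃ g : OperatorRange A, incl A g = A (ContinuousLinearMap.adjoint A k) ∧
      ∀ f : OperatorRange A, inner ℂ g f = inner ℂ k (incl A f) := by
  -- Vectors in the range of `A^*` are orthogonal to `ker A`, so `A^* k` is itself the preimage that
  -- defines the norm and inner product of `A A^* k` in `M(A)`.
  have hmem : ContinuousLinearMap.adjoint A k ∈ (LinearMap.ker (A : H →ₗ[ℂ] K))ᗮ := by
    intro x hx
    have hx : A x = 0 := hx
    rw [ContinuousLinearMap.adjoint_inner_right, hx, inner_zero_left]
  refine ⟨equiv A ⟨_, hmem⟩, incl_equiv A _, fun f => ?_⟩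
  obtain ⟨x, rfl⟩ := (equiv A).surjective f
  rw [incl_equiv, ← ContinuousLinearMap.adjoint_inner_left]
  change inner ℂ ((equiv A).symm _) ((equiv A).symm _) = _
  rw [LinearEquiv.symm_apply_apply, LinearEquiv.symm_apply_apply]
  rfl

end OperatorRange

/-- The reproducing kernel of `H(B)`. -/
lemma SchurFunction.exists_kernel (B : SchurFunction D E) (z : ℂ) (e : E) :
    ∃ g : B.Space, z ∈ ball (0 : ℂ) 1 →
      (∀ w ∈ ball (0 : ℂ) 1, g.eval w =
        (1 - w * conj z)⁻¹ • (e - B w (ContinuousLinearMap.adjoint (B z) e))) ∧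
      ∀ f : B.Space, inner ℂ g f = inner ℂ e (f.eval z) := by
  obtain ⟨g, hg, hinner⟩ := OperatorRange.exists_inner_eq (defectOp B.mulOp) (szego z e)
  refine ⟨g, fun hz => ⟨fun w hw => ?_, fun f => ?_⟩⟩
  -- The defect operator is self-adjoint with square `I - T_B T_B^*`, so the kernel is this operator
  -- applied to the Szegő kernel.
  · have h1 : OperatorRange.incl _ g = szego z e +
        (-1 : ℂ) • B.mulOp (szego z (ContinuousLinearMap.adjoint (B z) e)) := by
      rw [hg, (isPositive_defectOp B.mulOp).isSelfAdjoint.adjoint_eq,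
        ← mul_apply_eq_comp, defectOp_mul_self _ B.norm_mulOp_le,
        ← adjoint_mulOp_szego B hz]
      simp [sub_eq_add_neg]
    rw [SchurFunction.Space.eval, h1, Hardy.eval_add _ _ hw, Hardy.eval_smul _ _ hw,
      B.eval_mulOp _ hw, eval_szego hz hw, eval_szego hz hw, map_smul, smul_sub, neg_one_smul,
      ← sub_eq_add_neg]
  · rw [hinner, inner_szego hz]
    rfl

end Kernels

/-! ### Row vectors: Cauchy–Schwarz and weak-* compactness -/

section RowVectors

variable {D : Type*} [NormedAddCommGroup D] [InnerProductSpace ℂ D] [CompleteSpace D]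

lemma inner_adjoint_one (β : D →L[ℂ] ℂ) (x : D) :
    inner ℂ (ContinuousLinearMap.adjoint β 1) x = β x := by
  rw [ContinuousLinearMap.adjoint_inner_left]
  simp

lemma mulStar_eq_inner (β ξ : D →L[ℂ] ℂ) :
    mulStar β ξ =
      inner ℂ (ContinuousLinearMap.adjoint β 1) (ContinuousLinearMap.adjoint ξ 1) :=
  (inner_adjoint_one β _).symm

lemma norm_adjoint_one (β : D →L[ℂ] ℂ) : ‖ContinuousLinearMap.adjoint β 1‖ = ‖β‖ := by
  have h : InnerProductSpace.toDual ℂ D (ContinuousLinearMap.adjoint β 1) = β := by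
    ext x
    rw [InnerProductSpace.toDual_apply_apply, inner_adjoint_one]
  rw [← (InnerProductSpace.toDual ℂ D).norm_map, h]

lemma conj_mulStar (β ξ : D →L[ℂ] ℂ) : conj (mulStar β ξ) = mulStar ξ β := by
  rw [mulStar_eq_inner, inner_conj_symm, ← mulStar_eq_inner]

lemma mulStar_self (β : D →L[ℂ] ℂ) : mulStar β β = (‖β‖ ^ 2 : ℝ) := by
  rw [mulStar_eq_inner, inner_self_eq_norm_sq_to_K, norm_adjoint_one]
  simp

lemma norm_mulStar_le (β ξ : D →L[ℂ] ℂ) : ‖mulStar β ξ‖ ≤ ‖β‖ * ‖ξ‖ := by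
  rw [mulStar_eq_inner, ← norm_adjoint_one β, ← norm_adjoint_one ξ]
  exact norm_inner_le_norm _ _

lemma norm_sub_sq_eq_mulStar (β ξ : D →L[ℂ] ℂ) :
    ‖β - ξ‖ ^ 2 = ‖β‖ ^ 2 - 2 * (mulStar β ξ).re + ‖ξ‖ ^ 2 := by
  rw [← norm_adjoint_one (β - ξ), map_sub, sub_apply, @norm_sub_sq ℂ, norm_adjoint_one,
    norm_adjoint_one, ← mulStar_eq_inner]
  rfl

/-- Equality in the Cauchy–Schwarz inequality. -/
lemma eq_of_mulStar_eq_one {β ξ : D →L[ℂ] ℂ} (hβ : ‖β‖ ≤ 1) (hξ : ‖ξ‖ ≤ 1)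
    (h : mulStar β ξ = 1) : β = ξ := by
  have h1 := norm_sub_sq_eq_mulStar β ξ
  rw [h, Complex.one_re] at h1
  have h2 : ‖β - ξ‖ ^ 2 ≤ 0 := by
    rw [h1]
    nlinarith [norm_nonneg β, norm_nonneg ξ]
  exact sub_eq_zero.1 (norm_eq_zero.1 (pow_eq_zero_iff two_ne_zero |>.1
    (le_antisymm h2 (by positivity))))

/-- A quantitative form of equality in Cauchy–Schwarz: ‖u - ξ‖² ≤ 2 - 2 Re(u ξ*) in the unit ball.
It upgrades convergence against the single vector ξ to norm convergence. -/
lemma tendsto_of_mulStar_tendsto_one {ι : Type*} {F : Filter ι} {u : ι → D →L[ℂ] ℂ}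
    {ξ : D →L[ℂ] ℂ} (hu : ∀ᶠ i in F, ‖u i‖ ≤ 1) (hξ : ‖ξ‖ ≤ 1)
    (h : Tendsto (fun i => mulStar (u i) ξ) F (𝓝 1)) : Tendsto u F (𝓝 ξ) := by
  rw [tendsto_iff_norm_sub_tendsto_zero]
  have h1 : Tendsto (fun i => √(2 - 2 * (mulStar (u i) ξ).re)) F (𝓝 0) := by
    have h2 := (((Complex.continuous_re.tendsto _).comp h).const_mul 2).const_sub 2
    simpa using h2.sqrt
  refine squeeze_zero' (Eventually.of_forall fun i => norm_nonneg _) ?_ h1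
  filter_upwards [hu] with i hi
  refine Real.le_sqrt_of_sq_le ?_
  rw [norm_sub_sq_eq_mulStar]
  nlinarith [norm_nonneg (u i), norm_nonneg ξ]

/-- Bounded nets of functionals have weak-* limit points. -/
lemma exists_tendsto_apply_of_norm_le {H ι : Type*} [NormedAddCommGroup H] [NormedSpace ℂ H]
    (U : Ultrafilter ι) (u : ι → H →L[ℂ] ℂ) (C : ℝ) (hu : ∀ᶠ i in U, ‖u i‖ ≤ C) :
    ∃ φ : H →L[ℂ] ℂ, ‖φ‖ ≤ C ∧ ∀ x, Tendsto (fun i => u i x) U (𝓝 (φ x)) := by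
  -- Banach–Alaoglu: an ultrafilter that lives on a weak-* compact ball converges there.
  have hc := WeakDual.isCompact_closedBall (𝕜 := ℂ) (E := H) 0 C
  obtain ⟨φ, hφ, hle⟩ := hc.ultrafilter_le_nhds (U.map fun i => StrongDual.toWeakDual (u i)) (by
    rw [le_principal_iff, Ultrafilter.mem_coe, Ultrafilter.mem_map]
    filter_upwards [hu] with i hi
    simpa using hi)
  refine ⟨WeakDual.toStrongDual φ, by simpa using hφ, fun x => ?_⟩
  exact ((WeakDual.eval_continuous x).tendsto φ).comp hle

end RowVectors

/-! ### Non-tangential limits -/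

section Nontangential

lemma tendsto_nontangential_iff {X : Type*} {lam : ℂ} {f : ℂ → X} {l : Filter X} :
    Tendsto f (nontangential lam) l ↔
      ∀ α : ℝ, 1 < α → Tendsto f (𝓝[approachRegion lam α] lam) l := by
  simp only [nontangential, tendsto_iSup, Set.mem_Ioi]

lemma nontangential_le (lam : ℂ) : nontangential lam ≤ 𝓝[ball (0 : ℂ) 1] lam :=
  iSup₂_le fun _ _ => nhdsWithin_mono _ fun _ hz => mem_ball_zero_iff.2 hz.1

lemma tendsto_radial (lam : sphere (0 : ℂ) 1) :
    Tendsto (fun r : ℝ => (r : ℂ) * lam) (𝓝[<] 1) (nontangential lam) := by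
  have hn : ‖(lam : ℂ)‖ = 1 := by simp
  have h : Tendsto (fun r : ℝ => (r : ℂ) * lam) (𝓝[<] 1) (𝓝[approachRegion lam 2] (lam : ℂ)) := by
    refine tendsto_nhdsWithin_iff.2 ⟨?_, ?_⟩
    · have h1 : Continuous fun r : ℝ => (r : ℂ) * lam := by fun_prop
      simpa using (h1.tendsto 1).mono_left nhdsWithin_le_nhds
    · filter_upwards [Ioo_mem_nhdsLT (zero_lt_one (α := ℝ))] with r hr
      have h1 : ‖(r : ℂ) * lam‖ = r := by
        rw [norm_mul, hn, mul_one, Complex.norm_real, Real.norm_of_nonneg hr.1.le]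
      have h2 : ‖(r : ℂ) * lam - lam‖ = 1 - r := by
        rw [← sub_one_mul, norm_mul, hn, mul_one, ← Complex.ofReal_one, ← Complex.ofReal_sub,
          Complex.norm_real, Real.norm_of_nonpos (by linarith [hr.2]), neg_sub]
      refine ⟨by rw [h1]; exact hr.2, ?_⟩
      rw [h1, h2]
      linarith [hr.2]
  exact h.mono_right (le_iSup₂_of_le 2 (by norm_num) le_rfl)

instance (lam : sphere (0 : ℂ) 1) : (nontangential lam).NeBot := (tendsto_radial lam).neBot

lemma norm_one_sub_mul_conj (lam : sphere (0 : ℂ) 1) (z : ℂ) :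
    ‖1 - z * conj (lam : ℂ)‖ = ‖z - lam‖ := by
  have hn : ‖(lam : ℂ)‖ = 1 := by simp
  have h : (lam : ℂ) * conj (lam : ℂ) = 1 := by
    rw [Complex.mul_conj, Complex.normSq_eq_norm_sq, hn]; simp
  rw [← h, ← sub_mul, norm_mul, RCLike.norm_conj, hn, mul_one, norm_sub_rev]

/-- If `b` has the real angular derivative `l` at `λ`, then `(1 - |b|²) / (1 - |z|²)` has the
non-tangential limit `l`. -/
lemma tendsto_one_sub_normSq_div {lam : sphere (0 : ℂ) 1} {b : ℂ → ℂ} {l : ℝ}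
    (h : Tendsto (fun z => (1 - b z) / (1 - z * conj (lam : ℂ))) (nontangential lam)
      (𝓝 (l : ℂ))) :
    Tendsto (fun z => (1 - ‖b z‖ ^ 2) / (1 - ‖z‖ ^ 2)) (nontangential lam) (𝓝 l) := by
  rw [tendsto_nontangential_iff] at h ⊢
  intro α hα
  have hg := h α hα
  set g : ℂ → ℂ := fun z => (1 - b z) / (1 - z * conj (lam : ℂ)) with hgdef
  have hn : ‖(lam : ℂ)‖ = 1 := by simp
  have hu : Tendsto (fun z : ℂ => ‖z - lam‖) (𝓝[approachRegion lam α] (lam : ℂ)) (𝓝 0) := by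
    have h1 : Continuous fun z : ℂ => ‖z - lam‖ := by fun_prop
    simpa using (h1.tendsto (lam : ℂ)).mono_left nhdsWithin_le_nhds
  rw [tendsto_iff_norm_sub_tendsto_zero]
  have hbound : Tendsto (fun z => α * (2 * ‖g z - l‖ + |‖g z‖ ^ 2 - l| * ‖z - lam‖))
      (𝓝[approachRegion lam α] (lam : ℂ)) (𝓝 0) := by
    have h1 : Tendsto (fun z => ‖g z - l‖) (𝓝[approachRegion lam α] (lam : ℂ)) (𝓝 0) :=
      tendsto_iff_norm_sub_tendsto_zero.1 hg
    have h2 := ((hg.norm.pow 2).sub_const l).abs.mul hu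
    simpa using ((h1.const_mul 2).add h2).const_mul α
  refine squeeze_zero' (Eventually.of_forall fun z => norm_nonneg _) ?_ hbound
  filter_upwards [self_mem_nhdsWithin] with z hz
  have hz1 : ‖z‖ < 1 := hz.1
  have hpos : 0 < 1 - ‖z‖ ^ 2 := by nlinarith [norm_nonneg z]
  set u : ℂ := 1 - z * conj (lam : ℂ) with hudef
  have hun : ‖u‖ = ‖z - lam‖ := norm_one_sub_mul_conj lam z
  have hu0 : u ≠ 0 := mul_conj_ne_one hn.le (by simpa using hz1)
  have hb : b z = 1 - g z * u := by
    rw [hgdef]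
    simp only
    rw [div_mul_cancel₀ _ hu0, sub_sub_cancel]
  have hzz : ‖z‖ ^ 2 = ‖1 - u‖ ^ 2 := by
    rw [hudef, sub_sub_cancel, norm_mul, RCLike.norm_conj, hn, mul_one]
  -- With b = 1 - g u and |z| = |1 - u|, one has 1 - |b|² = 2 Re(g u) - |g|²|u|² and 1 - |z|² = 2 Re
  -- u - |u|². As l is real, the first-order terms combine into 2 Re((g - l) u).
  have key : (1 - ‖b z‖ ^ 2) - l * (1 - ‖z‖ ^ 2) =
      2 * ((g z - l) * u).re - (‖g z‖ ^ 2 - l) * ‖u‖ ^ 2 := by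
    rw [hb, hzz]
    simp only [← Complex.normSq_eq_norm_sq, Complex.normSq_apply, Complex.sub_re, Complex.sub_im,
      Complex.mul_re, Complex.mul_im, Complex.one_re, Complex.one_im, Complex.ofReal_re,
      Complex.ofReal_im]
    ring
  -- Here the approach region enters: an error that is o(|u|) is also o(1 - |z|²).
  have hule : ‖u‖ ≤ α * (1 - ‖z‖ ^ 2) := by
    rw [hun]
    refine hz.2.le.trans ?_
    have : ‖z‖ ^ 2 ≤ ‖z‖ := by nlinarith [norm_nonneg z]
    gcongr
  rw [Real.norm_eq_abs, div_sub' hpos.ne', abs_div, abs_of_pos hpos, div_le_iff₀ hpos,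
    mul_comm (1 - ‖z‖ ^ 2) l, key]
  calc |2 * ((g z - l) * u).re - (‖g z‖ ^ 2 - l) * ‖u‖ ^ 2|
      ≤ 2 * (‖g z - l‖ * ‖u‖) + |‖g z‖ ^ 2 - l| * ‖u‖ ^ 2 := by
        refine (abs_sub _ _).trans ?_
        rw [abs_mul, abs_mul, abs_of_pos (zero_lt_two (α := ℝ)), abs_of_nonneg (sq_nonneg ‖u‖),
          ← norm_mul]
        gcongr
        exact Complex.abs_re_le_norm _
    _ = (2 * ‖g z - l‖ + |‖g z‖ ^ 2 - l| * ‖u‖) * ‖u‖ := by ring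
    _ ≤ (2 * ‖g z - l‖ + |‖g z‖ ^ 2 - l| * ‖u‖) * (α * (1 - ‖z‖ ^ 2)) := by gcongr
    _ = α * (2 * ‖g z - l‖ + |‖g z‖ ^ 2 - l| * ‖z - lam‖) * (1 - ‖z‖ ^ 2) := by rw [hun]; ring

end Nontangential

/-! ### The Herglotz representation and point masses -/

section Herglotz

/-- The Schwarz integral formula: the Herglotz–Riesz kernel recovers an analytic function from its
real part on the circle. -/
lemma circleAverage_herglotzRieszKernel_re {G : ℂ → ℂ} (hG : DiffContOnCl ℂ G (ball 0 1))
    {z : ℂ} (hz : z ∈ ball (0 : ℂ) 1) :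
    Real.circleAverage (fun ζ => herglotzRieszKernel 0 z ζ • ((G ζ).re : ℂ)) 0 1 +
      Complex.I * ((G 0).im : ℂ) = G z := by
  have hcont : ContinuousOn G (sphere 0 1) := by
    refine hG.continuousOn.mono ?_
    rw [closure_ball _ one_ne_zero]
    exact sphere_subset_closedBall
  have hci : CircleIntegrable (fun ζ => (G ζ).re) 0 1 :=
    (Complex.continuous_re.comp_continuousOn hcont).circleIntegrable zero_le_one
  have hciC : CircleIntegrable (fun ζ => ((G ζ).re : ℂ)) 0 1 :=
    (Complex.continuous_ofReal.comp_continuousOn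
      (Complex.continuous_re.comp_continuousOn hcont)).circleIntegrable zero_le_one
  set F : ℂ → ℂ := fun w =>
    Real.circleAverage (fun ζ => herglotzRieszKernel 0 w ζ • ((G ζ).re : ℂ)) 0 1 with hF
  -- Taking real parts reduces this to the Poisson formula for G.
  have hre : ∀ w ∈ ball (0 : ℂ) 1, (F w).re = (G w).re := by
    intro w hw
    rw [hF]
    simp only
    rw [re_circleAverage_herglotzRieszKernel_smul hci hw,
      ← hG.circleAverage_re_herglotzRieszKernel_smul hw]
    have h1 : CircleIntegrable ((Complex.re ∘ herglotzRieszKernel 0 w) • G) 0 1 := by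
      refine ContinuousOn.circleIntegrable zero_le_one ?_
      refine ContinuousOn.smul ?_ hcont
      have := continuousOn_herglotzRieszKernel_sphere hw
      rw [abs_one] at this
      exact Complex.continuous_re.comp_continuousOn this
    have h2 := Complex.reCLM.circleAverage_comp_comm h1
    refine Eq.trans ?_ h2
    congr 1
    funext ζ
    simp [Function.comp_def]
  have hFd : DifferentiableOn ℂ F (ball 0 1) :=
    differentiableOn_circleAverage_herglotzRieszKernel_smul hciC
  -- An analytic function with zero real part on the disc is constant. The constant is found at 0,
  -- where the kernel is 1 and F is therefore real.
  obtain ⟨c, hc⟩ := AnalyticOnNhd.eq_const_of_re_eq_const (f := fun w => G w - F w) (c₀ := 0)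
    ((hG.differentiableOn.sub hFd).analyticOnNhd isOpen_ball)
    (fun w hw => by simp [hre w hw]) isOpen_ball
    ((convex_ball (0 : ℂ) 1).isConnected (nonempty_ball.2 one_pos))
  have h0 : (0 : ℂ) ∈ ball (0 : ℂ) 1 := mem_ball_self one_pos
  have hF0 : (F 0).im = 0 := by
    have h1 : F 0 = ((Real.circleAverage (fun ζ => (G ζ).re) 0 1 : ℝ) : ℂ) := by
      have h2 := Complex.ofRealCLM.circleAverage_comp_comm hci
      refine Eq.trans ?_ h2
      refine Real.circleAverage_congr_sphere fun ζ hζ => ?_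
      have : ζ ≠ 0 := by
        rintro rfl
        simp at hζ
      simp [herglotzRieszKernel_def, this]
    rw [h1, Complex.ofReal_im]
  have hc' : c = Complex.I * ((G 0).im : ℂ) := by
    rw [← hc 0 h0]
    apply Complex.ext
    · simp [hre 0 h0]
    · simp [hF0]
  rw [← hc', ← hc z hz]
  ring

/-- The measure on the unit circle with density `g` with respect to normalized arc length. -/
lemma exists_measure_circle_density {g : ℂ → ℝ} (hg : ContinuousOn g (sphere 0 1))
    (hg0 : ∀ ζ ∈ sphere (0 : ℂ) 1, 0 ≤ g ζ) :
    ∃ μ : FiniteMeasure (sphere (0 : ℂ) 1), ∀ f : ℂ → ℂ, ContinuousOn f (sphere 0 1) →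
      ∫ ζ : sphere (0 : ℂ) 1, f ζ ∂(μ : Measure (sphere (0 : ℂ) 1)) =
        Real.circleAverage (fun ζ => f ζ • (g ζ : ℂ)) 0 1 := by
  have hmem : ∀ θ : ℝ, circleMap 0 1 θ ∈ sphere (0 : ℂ) 1 := fun θ =>
    circleMap_mem_sphere 0 zero_le_one θ
  have hgc : Continuous fun θ : ℝ => (2 * Real.pi)⁻¹ * g (circleMap 0 1 θ) :=
    continuous_const.mul (hg.comp_continuous (continuous_circleMap 0 1) hmem)
  have hgnn : ∀ θ : ℝ, 0 ≤ (2 * Real.pi)⁻¹ * g (circleMap 0 1 θ) := fun θ =>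
    mul_nonneg (by positivity) (hg0 _ (hmem θ))
  set ν : Measure ℝ := (volume.restrict (Set.Ioc 0 (2 * Real.pi))).withDensity
    fun θ => ENNReal.ofReal ((2 * Real.pi)⁻¹ * g (circleMap 0 1 θ)) with hν
  have hfin : IsFiniteMeasure ν :=
    isFiniteMeasure_withDensity_ofReal (hgc.integrableOn_Ioc).2
  set c : ℝ → sphere (0 : ℂ) 1 := fun θ => ⟨circleMap 0 1 θ, hmem θ⟩ with hcdef
  have hc : Continuous c := (continuous_circleMap 0 1).subtype_mk _
  refine ⟨⟨ν.map c, inferInstance⟩, fun f hf => ?_⟩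
  have hfs : Continuous fun ζ : sphere (0 : ℂ) 1 => f ζ :=
    hf.comp_continuous continuous_subtype_val fun ζ => ζ.2
  rw [FiniteMeasure.toMeasure_mk, integral_map hc.aemeasurable hfs.aestronglyMeasurable, hν,
    integral_withDensity_eq_integral_toReal_smul hgc.measurable.ennreal_ofReal
      (Eventually.of_forall fun _ => ENNReal.ofReal_lt_top), Real.circleAverage_def,
    intervalIntegral.integral_of_le (by positivity), ← integral_smul]
  refine integral_congr_ae (Eventually.of_forall fun θ => ?_)
  simp only [hcdef, ENNReal.toReal_ofReal (hgnn θ), Complex.real_smul, smul_eq_mul,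
    Complex.ofReal_mul]
  ring

lemma continuousOn_herglotz_kernel {z : ℂ} (hz : z ∈ ball (0 : ℂ) 1) :
    ContinuousOn (fun ζ : ℂ => (ζ + z) / (ζ - z)) (sphere 0 1) := by
  refine ContinuousOn.div (by fun_prop) (by fun_prop) fun ζ hζ h => ?_
  rw [sub_eq_zero] at h
  rw [mem_sphere_zero_iff_norm, h] at hζ
  rw [mem_ball_zero_iff, hζ] at hz
  exact lt_irrefl _ hz

/-- The Herglotz representation theorem. -/
theorem exists_herglotz_measure {H : ℂ → ℂ} (hH : DifferentiableOn ℂ H (ball 0 1))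
    (hre : ∀ z ∈ ball (0 : ℂ) 1, 0 ≤ (H z).re) :
    ∃ μ : Measure (sphere (0 : ℂ) 1), IsFiniteMeasure μ ∧ ∀ z ∈ ball (0 : ℂ) 1,
      H z = ∫ ζ : sphere (0 : ℂ) 1, ((ζ : ℂ) + z) / ((ζ : ℂ) - z) ∂μ +
        Complex.I * ((H 0).im : ℂ) := by
  have hscale : ∀ r ∈ Set.Ioo (0 : ℝ) 1, ∀ z ∈ closedBall (0 : ℂ) 1,
      (r : ℂ) * z ∈ ball (0 : ℂ) 1 := by
    intro r hr z hz
    rw [mem_closedBall_zero_iff] at hz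
    rw [mem_ball_zero_iff, norm_mul, Complex.norm_real, Real.norm_of_nonneg hr.1.le]
    nlinarith [hr.1, hr.2, norm_nonneg z]
  -- The dilates H(r·) are continuous up to the circle, so the Schwarz formula represents them by
  -- the density Re H(rζ). For r outside (0, 1) the zero measure is a default that makes the family
  -- total.
  have hex : ∀ r : ℝ, ∃ μ : FiniteMeasure (sphere (0 : ℂ) 1), r ∈ Set.Ioo (0 : ℝ) 1 →
      ∀ z ∈ ball (0 : ℂ) 1, H (r * z) =
        ∫ ζ : sphere (0 : ℂ) 1, ((ζ : ℂ) + z) / ((ζ : ℂ) - z)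
          ∂(μ : Measure (sphere (0 : ℂ) 1)) + Complex.I * ((H 0).im : ℂ) := by
    intro r
    by_cases hr : r ∈ Set.Ioo (0 : ℝ) 1
    swap
    · exact ⟨0, fun h => absurd h hr⟩
    have hc : ContinuousOn (fun z => H (r * z)) (closedBall 0 1) :=
      hH.continuousOn.comp (by fun_prop) (hscale r hr)
    have hG : DiffContOnCl ℂ (fun z => H (r * z)) (ball 0 1) := by
      refine ⟨hH.comp (by fun_prop) fun z hz => hscale r hr z (ball_subset_closedBall hz), ?_⟩
      rwa [closure_ball _ one_ne_zero]
    obtain ⟨μ, hμ⟩ := exists_measure_circle_density (g := fun ζ => (H (r * ζ)).re)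
      (Complex.continuous_re.comp_continuousOn (hc.mono sphere_subset_closedBall))
      fun ζ hζ => hre _ (hscale r hr ζ (sphere_subset_closedBall hζ))
    refine ⟨μ, fun _ z hz => ?_⟩
    have h1 := circleAverage_herglotzRieszKernel_re hG hz
    simp only [herglotzRieszKernel_def, sub_zero, mul_zero] at h1
    rw [hμ _ (continuousOn_herglotz_kernel hz)]
    exact h1.symm
  choose μ hμ using hex
  have h0 : (0 : ℂ) ∈ ball (0 : ℂ) 1 := mem_ball_self one_pos
  have hne : ∀ ζ : sphere (0 : ℂ) 1, (ζ : ℂ) ≠ 0 := fun ζ h => by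
    have := ζ.2
    rw [h] at this
    simp at this
  -- At z = 0 the Herglotz kernel is 1, so each mass is Re H(0). This uniform bound gives a weak
  -- limit measure as r → 1.
  have hmass : ∀ r ∈ Set.Ioo (0 : ℝ) 1, (μ r).mass ≤ (H 0).re.toNNReal := by
    intro r hr
    have h1 := hμ r hr 0 h0
    simp only [mul_zero, add_zero, sub_zero, div_self (hne _), integral_const,
      mul_one, Complex.real_smul] at h1
    have h2 := congrArg Complex.re h1
    simp only [Complex.add_re, Complex.ofReal_re, Complex.mul_re, Complex.I_re, zero_mul,
      Complex.I_im, Complex.ofReal_im, mul_zero, sub_zero, add_zero] at h2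
    refine NNReal.le_toNNReal_of_coe_le ?_
    rw [h2]
    exact le_rfl
  set U : Ultrafilter ℝ := Ultrafilter.of (𝓝[<] (1 : ℝ)) with hU
  have hUle : (U : Filter ℝ) ≤ 𝓝[<] 1 := Ultrafilter.of_le _
  have hIoo : ∀ᶠ r in (U : Filter ℝ), r ∈ Set.Ioo (0 : ℝ) 1 :=
    hUle (Ioo_mem_nhdsLT (zero_lt_one (α := ℝ)))
  obtain ⟨ν, -, hν⟩ := (isCompact_setOfPred_finiteMeasure_le_of_compactSpace
    (sphere (0 : ℂ) 1) (H 0).re.toNNReal).ultrafilter_le_nhds (U.map μ) (by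
      rw [le_principal_iff, Ultrafilter.mem_coe, Ultrafilter.mem_map]
      filter_upwards [hIoo] with r hr using hmass r hr)
  have hlim : Tendsto μ U (𝓝 ν) := hν
  rw [FiniteMeasure.tendsto_iff_forall_integral_rclike_tendsto ℂ] at hlim
  refine ⟨ν, inferInstance, fun z hz => ?_⟩
  have hk : Continuous fun ζ : sphere (0 : ℂ) 1 => ((ζ : ℂ) + z) / ((ζ : ℂ) - z) :=
    (continuousOn_herglotz_kernel hz).comp_continuous continuous_subtype_val fun ζ => ζ.2
  have h1 := (hlim (BoundedContinuousFunction.mkOfCompact ⟨_, hk⟩)).add_const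
    (Complex.I * ((H 0).im : ℂ))
  have h2 : Tendsto (fun r : ℝ => H (r * z)) U (𝓝 (H z)) := by
    have h3 : Tendsto (fun r : ℝ => (r : ℂ) * z) (𝓝[<] 1) (𝓝 z) := by
      have h4 : Continuous fun r : ℝ => (r : ℂ) * z := by fun_prop
      simpa using (h4.tendsto 1).mono_left nhdsWithin_le_nhds
    exact ((hH.continuousOn.continuousAt (isOpen_ball.mem_nhds hz)).tendsto.comp h3).mono_left
      hUle
  refine tendsto_nhds_unique h2 (h1.congr' ?_)
  filter_upwards [hIoo] with r hr
  exact (hμ r hr z hz).symm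

/-- The Herglotz integral of `μ` detects the mass of `μ` at a point of the circle. -/
lemma tendsto_mul_herglotz_integral (μ : Measure (sphere (0 : ℂ) 1)) [IsFiniteMeasure μ]
    (lam : sphere (0 : ℂ) 1) :
    Tendsto (fun r : ℝ => ((1 - r : ℝ) : ℂ) *
      ∫ ζ : sphere (0 : ℂ) 1, ((ζ : ℂ) + r * lam) / ((ζ : ℂ) - r * lam) ∂μ) (𝓝[<] 1)
      (𝓝 ((2 * μ.real {lam} : ℝ) : ℂ)) := by
  have hn : ∀ ζ : sphere (0 : ℂ) 1, ‖(ζ : ℂ)‖ = 1 := fun ζ => by simp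
  have hlam : (lam : ℂ) ≠ 0 := fun h => by simpa [h] using hn lam
  -- The integrand (1 - r)(ζ + rλ)/(ζ - rλ) equals 1 + r at ζ = λ and tends to 0 elsewhere. It is
  -- dominated by 2, because |ζ - rλ| ≥ 1 - r and |ζ + rλ| ≤ 2.
  have hint : ((2 * μ.real {lam} : ℝ) : ℂ) =
      ∫ ζ : sphere (0 : ℂ) 1, Set.indicator {lam} (fun _ => (2 : ℂ)) ζ ∂μ := by
    rw [integral_indicator_const _ (measurableSet_singleton lam), Complex.real_smul]
    push_cast
    ring
  simp_rw [hint, ← integral_const_mul]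
  have hnr : ∀ r ∈ Set.Ioo (0 : ℝ) 1, ‖(r : ℂ) * lam‖ = r := fun r hr => by
    rw [norm_mul, hn, mul_one, Complex.norm_real, Real.norm_of_nonneg hr.1.le]
  have hIoo := Ioo_mem_nhdsLT (zero_lt_one (α := ℝ))
  refine tendsto_integral_filter_of_dominated_convergence (fun _ => (2 : ℝ)) ?_ ?_
    (integrable_const _) ?_
  · filter_upwards [hIoo] with r hr
    refine Continuous.aestronglyMeasurable (continuous_const.mul ?_)
    exact (continuousOn_herglotz_kernel (by
      rw [mem_ball_zero_iff, hnr r hr]; exact hr.2)).comp_continuous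
      continuous_subtype_val fun ζ => ζ.2
  · filter_upwards [hIoo] with r hr
    refine Eventually.of_forall fun ζ => ?_
    have h1 : 1 - r ≤ ‖(ζ : ℂ) - r * lam‖ := by
      have := norm_sub_norm_le (ζ : ℂ) (r * lam)
      rwa [hn, hnr r hr] at this
    have h2 : ‖(ζ : ℂ) + r * lam‖ ≤ 2 := by
      have := norm_add_le (ζ : ℂ) (r * lam)
      rw [hn, hnr r hr] at this
      linarith [hr.2]
    have h3 : 0 < 1 - r := by linarith [hr.2]
    rw [norm_mul, norm_div, Complex.norm_real, Real.norm_of_nonneg h3.le, ← mul_div_assoc,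
      div_le_iff₀ (h3.trans_le h1)]
    nlinarith [norm_nonneg ((ζ : ℂ) + r * lam)]
  · refine Eventually.of_forall fun ζ => ?_
    have hr0 : Tendsto (fun r : ℝ => (r : ℂ)) (𝓝[<] 1) (𝓝 1) := by
      simpa using (Complex.continuous_ofReal.tendsto 1).mono_left nhdsWithin_le_nhds
    by_cases hζ : ζ = lam
    · subst hζ
      rw [Set.indicator_of_mem (Set.mem_singleton ζ)]
      have h1 : Tendsto (fun r : ℝ => 1 + (r : ℂ)) (𝓝[<] 1) (𝓝 2) := by
        convert! hr0.const_add 1 using 2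
        norm_num
      refine h1.congr' ?_
      filter_upwards [hIoo] with r hr
      have h2 : (1 : ℂ) - r ≠ 0 := by
        rw [← Complex.ofReal_one, ← Complex.ofReal_sub, Complex.ofReal_ne_zero]
        linarith [hr.2]
      push_cast
      field_simp
    · rw [Set.indicator_of_notMem (by simpa using hζ)]
      have h1 : (ζ : ℂ) - 1 * lam ≠ 0 := by
        rw [one_mul, sub_ne_zero]
        exact fun h => hζ (Subtype.ext h)
      have h2 := (hr0.const_sub 1).mul
        (((hr0.mul_const (lam : ℂ)).const_add (ζ : ℂ)).div
          ((hr0.mul_const (lam : ℂ)).const_sub (ζ : ℂ)) h1)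
      simpa using h2

end Herglotz

/-! ### Boundary kernels, the lower limit and Clark measures -/

section Caratheodory

variable {D : Type*} [NormedAddCommGroup D] [InnerProductSpace ℂ D]

lemma SchurFunction.eventually_norm_le_one (B : SchurFunction D ℂ) (lam : ℂ) :
    ∀ᶠ z in nontangential lam, z ∈ ball (0 : ℂ) 1 ∧ ‖B z‖ ≤ 1 := by
  filter_upwards [nontangential_le lam self_mem_nhdsWithin] with z hz
  exact ⟨hz, B.norm_le_one z hz⟩

variable [CompleteSpace D]

/-- `k` is the family of reproducing kernels of `H(B)`. -/
def IsKernel (B : SchurFunction D ℂ) (k : ℂ → B.Space) : Prop :=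
  ∀ z ∈ ball (0 : ℂ) 1,
    (∀ w ∈ ball (0 : ℂ) 1, (k z).eval w = (1 - mulStar (B w) (B z)) / (1 - w * conj z)) ∧
    ∀ f : B.Space, inner ℂ (k z) f = f.eval z

lemma exists_isKernel (B : SchurFunction D ℂ) : ∃ k : ℂ → B.Space, IsKernel B k := by
  choose k hk using fun z => B.exists_kernel z (1 : ℂ)
  refine ⟨k, fun z hz => ⟨fun w hw => ?_, fun f => ?_⟩⟩
  · rw [(hk z hz).1 w hw, smul_eq_mul, mul_comm, ← div_eq_mul_inv]
    rfl
  · rw [(hk z hz).2 f]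
    simp

lemma IsKernel.norm_sq {B : SchurFunction D ℂ} {k : ℂ → B.Space} (hk : IsKernel B k) {z : ℂ}
    (hz : z ∈ ball (0 : ℂ) 1) : ‖k z‖ ^ 2 = (1 - ‖B z‖ ^ 2) / (1 - ‖z‖ ^ 2) := by
  have h1 := (hk z hz).2 (k z)
  rw [(hk z hz).1 z hz, inner_self_eq_norm_sq_to_K, mulStar_self, Complex.mul_conj,
    Complex.normSq_eq_norm_sq] at h1
  refine Complex.ofReal_injective ?_
  push_cast at h1 ⊢
  exact h1

lemma IsKernel.norm_eval_le {B : SchurFunction D ℂ} {k : ℂ → B.Space} (hk : IsKernel B k) {z : ℂ}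
    (hz : z ∈ ball (0 : ℂ) 1) (f : B.Space) : ‖f.eval z‖ ≤ ‖k z‖ * ‖f‖ := by
  rw [← (hk z hz).2 f]
  exact norm_inner_le_norm _ _

lemma tendsto_one_sub_mul_conj (lam : sphere (0 : ℂ) 1) :
    Tendsto (fun z : ℂ => 1 - z * conj (lam : ℂ)) (𝓝 (lam : ℂ)) (𝓝 0) := by
  have h : Continuous fun z : ℂ => 1 - z * conj (lam : ℂ) := by fun_prop
  have h1 := h.tendsto (lam : ℂ)
  rwa [norm_eq_zero.1 ((norm_one_sub_mul_conj lam lam).trans (by simp))] at h1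

lemma tendsto_mulStar_of_caratheodory {B : SchurFunction D ℂ} {lam : sphere (0 : ℂ) 1}
    {ξ : D →L[ℂ] ℂ} {l : ℂ}
    (h : Tendsto (fun z => (1 - mulStar (B z) ξ) / (1 - z * conj (lam : ℂ)))
      (nontangential lam) (𝓝 l)) :
    Tendsto (fun z => mulStar (B z) ξ) (nontangential lam) (𝓝 1) := by
  have hn : ‖(lam : ℂ)‖ = 1 := by simp
  have h1 := (h.mul ((tendsto_one_sub_mul_conj lam).mono_left
    ((nontangential_le (lam : ℂ)).trans nhdsWithin_le_nhds))).const_sub 1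
  rw [mul_zero, sub_zero] at h1
  refine h1.congr' ?_
  filter_upwards [B.eventually_norm_le_one lam] with z hz
  rw [div_mul_cancel₀ _ (mul_conj_ne_one hn.le hz.1), sub_sub_cancel]

lemma tendsto_of_caratheodory {B : SchurFunction D ℂ} {lam : sphere (0 : ℂ) 1}
    {ξ : D →L[ℂ] ℂ} (hξ : ‖ξ‖ = 1) {l : ℂ}
    (h : Tendsto (fun z => (1 - mulStar (B z) ξ) / (1 - z * conj (lam : ℂ)))
      (nontangential lam) (𝓝 l)) :
    Tendsto (fun z => B z) (nontangential lam) (𝓝 ξ) :=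
  tendsto_of_mulStar_tendsto_one ((B.eventually_norm_le_one lam).mono fun _ hz => hz.2) hξ.le
    (tendsto_mulStar_of_caratheodory h)

lemma tendsto_mulStar_left {ι : Type*} {F : Filter ι} {u : ι → D →L[ℂ] ℂ} {ξ : D →L[ℂ] ℂ}
    (hu : Tendsto u F (𝓝 ξ)) (β : D →L[ℂ] ℂ) :
    Tendsto (fun i => mulStar (u i) β) F (𝓝 (mulStar ξ β)) :=
  ((ContinuousLinearMap.apply ℂ ℂ (ContinuousLinearMap.adjoint β 1)).continuous.tendsto ξ).comp hu

/-- Pointwise convergence suffices, since β u* is the conjugate of u evaluated at the vector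
representing β. This allows weak-* limits of B(z). -/
lemma tendsto_mulStar_right {ι : Type*} {F : Filter ι} {u : ι → D →L[ℂ] ℂ} {ξ : D →L[ℂ] ℂ}
    (hu : ∀ x, Tendsto (fun i => u i x) F (𝓝 (ξ x))) (β : D →L[ℂ] ℂ) :
    Tendsto (fun i => mulStar β (u i)) F (𝓝 (mulStar β ξ)) := by
  have h := (Complex.continuous_conj.tendsto _).comp
    (hu (ContinuousLinearMap.adjoint β 1))
  have h1 : ∀ γ : D →L[ℂ] ℂ, conj (γ (ContinuousLinearMap.adjoint β 1)) = mulStar β γ :=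
    fun γ => conj_mulStar γ β
  simpa only [Function.comp_def, h1] using h

/-- The angular derivative is the squared norm of a boundary kernel in `H(B)`. -/
lemma exists_boundary_kernel {B : SchurFunction D ℂ} {lam : sphere (0 : ℂ) 1}
    {ξ : D →L[ℂ] ℂ} (hξ : ‖ξ‖ = 1) {l : ℂ}
    (h : Tendsto (fun z => (1 - mulStar (B z) ξ) / (1 - z * conj (lam : ℂ)))
      (nontangential lam) (𝓝 l)) :
    ∃ g : B.Space, (∀ w ∈ ball (0 : ℂ) 1,
      g.eval w = (1 - mulStar (B w) ξ) / (1 - w * conj (lam : ℂ))) ∧ l = (‖g‖ ^ 2 : ℝ) := by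
  obtain ⟨k, hk⟩ := exists_isKernel B
  have hn : ‖(lam : ℂ)‖ = 1 := by simp
  have hrad := tendsto_radial lam
  have hball : ∀ᶠ r : ℝ in 𝓝[<] 1, (r : ℂ) * lam ∈ ball (0 : ℂ) 1 :=
    (hrad.eventually (B.eventually_norm_le_one lam)).mono fun _ h => h.1
  -- Eventually 1 - ‖B(rλ)‖ ≤ |1 - B(rλ)ξ*| ≤ (‖l‖ + 1)(1 - r); the 2 bounds the remaining factor (1
  -- + ‖B(rλ)‖)/(1 + r).
  have hbd : ∀ᶠ r : ℝ in 𝓝[<] 1, ‖k (r * lam)‖ ≤ √(2 * (‖l‖ + 1)) := by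
    have h1 := (h.comp hrad).norm.eventually (Iio_mem_nhds (lt_add_one ‖l‖))
    filter_upwards [h1, Ioo_mem_nhdsLT (zero_lt_one (α := ℝ)), hball] with r hr1 hr hb
    have hB := B.norm_le_one _ hb
    have hnr : ‖(r : ℂ) * lam‖ = r := by
      rw [norm_mul, hn, mul_one, Complex.norm_real, Real.norm_of_nonneg hr.1.le]
    have hu : ‖1 - (r : ℂ) * lam * conj (lam : ℂ)‖ = 1 - r := by
      rw [norm_one_sub_mul_conj, ← sub_one_mul, norm_mul, hn, mul_one, ← Complex.ofReal_one,
        ← Complex.ofReal_sub, Complex.norm_real, Real.norm_of_nonpos (by linarith [hr.2]), neg_sub]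
    have hr0 : 0 < 1 - r := by linarith [hr.2]
    simp only [Function.comp_apply, norm_div, hu] at hr1
    rw [div_lt_iff₀ hr0] at hr1
    have h2 : 1 - ‖B (r * lam)‖ ≤ ‖1 - mulStar (B (r * lam)) ξ‖ := by
      have h3 := norm_sub_norm_le 1 (mulStar (B (r * lam)) ξ)
      have h4 := norm_mulStar_le (B (r * lam)) ξ
      rw [hξ, mul_one] at h4
      rw [norm_one] at h3
      linarith
    refine Real.le_sqrt_of_sq_le ?_
    rw [hk.norm_sq hb, hnr, div_le_iff₀ (by nlinarith [hr.1, hr.2])]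
    nlinarith [norm_nonneg (B (r * lam)), hr.1, norm_nonneg l, mul_pos hr.1 hr0,
      mul_nonneg (norm_nonneg l) hr0.le, mul_nonneg (norm_nonneg l) (mul_pos hr.1 hr0).le]
  set U : Ultrafilter ℝ := Ultrafilter.of (𝓝[<] (1 : ℝ)) with hU
  have hUle : (U : Filter ℝ) ≤ 𝓝[<] 1 := Ultrafilter.of_le _
  obtain ⟨φ, -, hφ⟩ := exists_tendsto_apply_of_norm_le U
    (fun r : ℝ => innerSL ℂ (k (r * lam))) (√(2 * (‖l‖ + 1)))
    (hUle (hbd.mono fun r hr => by rwa [innerSL_apply_norm]))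
  simp only [innerSL_apply_apply] at hφ
  have hφeval : ∀ f : B.Space, Tendsto (fun r : ℝ => f.eval (r * lam)) U (𝓝 (φ f)) := fun f =>
    (hφ f).congr' (hUle (hball.mono fun r hr => (hk _ hr).2 f))
  have hBlim : Tendsto (fun r : ℝ => B (r * lam)) U (𝓝 ξ) :=
    ((tendsto_of_caratheodory hξ h).comp hrad).mono_left hUle
  have hlam : Tendsto (fun r : ℝ => (r : ℂ) * lam) U (𝓝 (lam : ℂ)) :=
    hrad.mono_left hUle |>.mono_right ((nontangential_le _).trans nhdsWithin_le_nhds)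
  -- This is the weak limit of the kernels at rλ. Its value at w is the conjugate of the limit of
  -- K_w(rλ), which identifies it.
  set g : B.Space := (InnerProductSpace.toDual ℂ B.Space).symm φ with hg
  have hginner : ∀ f, inner ℂ g f = φ f := fun f => InnerProductSpace.toDual_symm_apply
  have hgeval : ∀ w ∈ ball (0 : ℂ) 1,
      g.eval w = (1 - mulStar (B w) ξ) / (1 - w * conj (lam : ℂ)) := by
    intro w hw
    have h1 : g.eval w = conj (φ (k w)) := by
      rw [← hginner, inner_conj_symm, (hk w hw).2]
    have hne : 1 - (lam : ℂ) * conj w ≠ 0 := by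
      intro h0
      refine mul_conj_ne_one hn.le hw ?_
      have := congrArg conj h0
      simpa [mul_comm] using this
    have h2 : Tendsto (fun r : ℝ => (k w).eval (r * lam)) U
        (𝓝 ((1 - mulStar ξ (B w)) / (1 - lam * conj w))) := by
      have h3 : Tendsto (fun r : ℝ => mulStar (B (r * lam)) (B w)) U (𝓝 (mulStar ξ (B w))) :=
        tendsto_mulStar_left hBlim _
      refine ((h3.const_sub 1).div ((hlam.mul_const (conj w)).const_sub 1) hne).congr' ?_
      filter_upwards [hUle hball] with r hr
      rw [(hk w hw).1 _ hr]
      rfl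
    rw [h1, tendsto_nhds_unique (hφeval (k w)) h2, map_div₀, map_sub, map_sub, map_mul,
      conj_mulStar, Complex.conj_conj, map_one, mul_comm (conj (lam : ℂ))]
  refine ⟨g, hgeval, ?_⟩
  -- g(rλ) is the Carathéodory quotient, which tends to l, and also ⟨K_{rλ}, g⟩, which tends to ⟨g,
  -- g⟩.
  have h1 : Tendsto (fun r : ℝ => g.eval (r * lam)) U (𝓝 l) := by
    refine ((h.comp hrad).mono_left hUle).congr' ?_
    filter_upwards [hUle hball] with r hr
    rw [hgeval _ hr]
    rfl
  rw [tendsto_nhds_unique h1 (hφeval g), ← hginner, inner_self_eq_norm_sq_to_K]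
  simp

/-- The kernels at interior points converge non-tangentially to the boundary kernel. -/
lemma IsKernel.tendsto_boundary_kernel {B : SchurFunction D ℂ} {k : ℂ → B.Space}
    (hk : IsKernel B k) {lam : sphere (0 : ℂ) 1} {ξ : D →L[ℂ] ℂ} (hξ : ‖ξ‖ = 1) {g : B.Space}
    (hg : ∀ w ∈ ball (0 : ℂ) 1, g.eval w = (1 - mulStar (B w) ξ) / (1 - w * conj (lam : ℂ)))
    (h : Tendsto (fun z => (1 - mulStar (B z) ξ) / (1 - z * conj (lam : ℂ)))
      (nontangential lam) (𝓝 ((‖g‖ ^ 2 : ℝ) : ℂ))) :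
    Tendsto k (nontangential lam) (𝓝 g) := by
  rw [tendsto_iff_norm_sub_tendsto_zero]
  have h1 := tendsto_one_sub_normSq_div h
  have h2 := ((h1.sub (((Complex.continuous_re.tendsto _).comp h).const_mul 2)).add_const
    (‖g‖ ^ 2)).sqrt
  rw [Complex.ofReal_re, show ‖g‖ ^ 2 - 2 * ‖g‖ ^ 2 + ‖g‖ ^ 2 = 0 by ring, Real.sqrt_zero] at h2
  refine squeeze_zero' (Eventually.of_forall fun z => norm_nonneg _) ?_ h2
  filter_upwards [B.eventually_norm_le_one lam] with z hz
  have hz1 : ‖z‖ < 1 := mem_ball_zero_iff.1 hz.1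
  have hpos : 0 < 1 - ‖z‖ ^ 2 := by nlinarith [norm_nonneg z]
  refine Real.le_sqrt_of_sq_le ?_
  rw [@norm_sub_sq ℂ, (hk z hz.1).2 g, hg z hz.1, hk.norm_sq hz.1, RCLike.re_to_complex,
    Function.comp_apply]
  -- Replacing ‖B(z)‖ by |B(z)ξ*| only increases ‖K_z‖², so the scalar limit in
  -- `tendsto_one_sub_normSq_div` is enough.
  have h3 : ‖mulStar (B z) ξ‖ ≤ ‖B z‖ := by
    simpa [hξ] using norm_mulStar_le (B z) ξ
  gcongr

/-- The angular derivative is a lower bound of `(1 - ‖B(z)‖) / (1 - |z|)` near `λ`. -/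
lemma IsKernel.norm_sq_le_of_frequently {B : SchurFunction D ℂ} {k : ℂ → B.Space}
    (hk : IsKernel B k) {lam : sphere (0 : ℂ) 1} {ξ : D →L[ℂ] ℂ} (hξ : ‖ξ‖ = 1) {g : B.Space}
    (hg : ∀ w ∈ ball (0 : ℂ) 1, g.eval w = (1 - mulStar (B w) ξ) / (1 - w * conj (lam : ℂ)))
    (h : Tendsto (fun z => (1 - mulStar (B z) ξ) / (1 - z * conj (lam : ℂ)))
      (nontangential lam) (𝓝 ((‖g‖ ^ 2 : ℝ) : ℂ))) {a : ℝ}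
    (ha : ∃ᶠ z in 𝓝[ball (0 : ℂ) 1] (lam : ℂ), (1 - ‖B z‖) / (1 - ‖z‖) < a) : ‖g‖ ^ 2 ≤ a := by
  have hn : ‖(lam : ℂ)‖ = 1 := by simp
  have : (𝓝[ball (0 : ℂ) 1] (lam : ℂ) ⊓ 𝓟 {z | (1 - ‖B z‖) / (1 - ‖z‖) < a}).NeBot :=
    frequently_mem_iff_neBot.1 ha
  set U : Ultrafilter ℂ := Ultrafilter.of
    (𝓝[ball (0 : ℂ) 1] (lam : ℂ) ⊓ 𝓟 {z | (1 - ‖B z‖) / (1 - ‖z‖) < a}) with hU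
  have hUle := Ultrafilter.of_le
    (𝓝[ball (0 : ℂ) 1] (lam : ℂ) ⊓ 𝓟 {z | (1 - ‖B z‖) / (1 - ‖z‖) < a})
  rw [← hU] at hUle
  have hball : ∀ᶠ z in (U : Filter ℂ), z ∈ ball (0 : ℂ) 1 :=
    (hUle.trans inf_le_left) self_mem_nhdsWithin
  have hlt : ∀ᶠ z in (U : Filter ℂ), (1 - ‖B z‖) / (1 - ‖z‖) < a :=
    (hUle.trans inf_le_right) (mem_principal_self _)
  have hUlam : (U : Filter ℂ) ≤ 𝓝 (lam : ℂ) := hUle.trans (inf_le_left.trans nhdsWithin_le_nhds)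
  have ha0 : 0 ≤ a := by
    obtain ⟨z, hz, hza⟩ := (hball.and hlt).exists
    have h1 := B.norm_le_one z hz
    have h2 : ‖z‖ < 1 := mem_ball_zero_iff.1 hz
    exact (div_nonneg (by linarith) (by linarith)).trans hza.le
  -- The ultrafilter may approach λ tangentially, so this weak-* limit of B(z) is not yet known to
  -- be ξ.
  obtain ⟨β, hβ, hβlim⟩ := exists_tendsto_apply_of_norm_le U (fun z => B z) 1
    (hball.mono fun z hz => B.norm_le_one z hz)
  -- Let z → λ in |K_z(w)|² ≤ ‖K_w‖² ‖K_z‖². Along the ultrafilter ‖K_z‖² ≤ 2a/(1 + |z|), whose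
  -- limit is a.
  have hineq : ∀ w ∈ ball (0 : ℂ) 1,
      ‖(1 - mulStar (B w) β) / (1 - w * conj (lam : ℂ))‖ ^ 2 ≤ ‖k w‖ ^ 2 * a := by
    intro w hw
    have hden : Tendsto (fun z : ℂ => 1 - w * conj z) U (𝓝 (1 - w * conj (lam : ℂ))) := by
      have : Continuous fun z : ℂ => 1 - w * conj z := by fun_prop
      exact (this.tendsto _).mono_left hUlam
    have h1 := ((((tendsto_mulStar_right hβlim (B w)).const_sub 1).div hden
      (mul_conj_ne_one hn.le hw)).norm.pow 2)
    have h2 : Tendsto (fun z : ℂ => ‖k w‖ ^ 2 * (a * (2 / (1 + ‖z‖)))) U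
        (𝓝 (‖k w‖ ^ 2 * (a * (2 / (1 + ‖(lam : ℂ)‖))))) := by
      have : Continuous fun z : ℂ => ‖k w‖ ^ 2 * (a * (2 / (1 + ‖z‖))) := by
        refine continuous_const.mul (continuous_const.mul (continuous_const.div (by fun_prop) ?_))
        intro z
        positivity
      exact (this.tendsto _).mono_left hUlam
    rw [hn, show (2 : ℝ) / (1 + 1) = 1 by norm_num, mul_one] at h2
    refine le_of_tendsto_of_tendsto h1 h2 ?_
    filter_upwards [hball, hlt] with z hz hza
    have hB := B.norm_le_one z hz
    have hz1 : ‖z‖ < 1 := mem_ball_zero_iff.1 hz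
    have hz0 : 0 < 1 - ‖z‖ := by linarith
    have h3 := hk.norm_eval_le hw (k z)
    rw [(hk z hz).1 w hw] at h3
    have h4 : ‖k z‖ ^ 2 ≤ a * (2 / (1 + ‖z‖)) := by
      have h5 : ‖k z‖ ^ 2 = (1 - ‖B z‖) / (1 - ‖z‖) * ((1 + ‖B z‖) / (1 + ‖z‖)) := by
        rw [hk.norm_sq hz, div_mul_div_comm]
        congr 1 <;> ring
      rw [h5]
      refine mul_le_mul hza.le ?_ (by positivity) ha0
      gcongr
      linarith
    calc _ ≤ (‖k w‖ * ‖k z‖) ^ 2 := by gcongr; exact h3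
      _ = ‖k w‖ ^ 2 * ‖k z‖ ^ 2 := by ring
      _ ≤ _ := by gcongr
  have hknorm : Tendsto (fun z => ‖k z‖ ^ 2 * a) (nontangential lam) (𝓝 (‖g‖ ^ 2 * a)) :=
    ((hk.tendsto_boundary_kernel hξ hg h).norm.pow 2).mul_const a
  have hBlim := tendsto_of_caratheodory hξ h
  have hden : Tendsto (fun z : ℂ => ‖1 - z * conj (lam : ℂ)‖ ^ 2) (nontangential lam) (𝓝 0) := by
    simpa using ((tendsto_one_sub_mul_conj lam).norm.pow 2).mono_left
      ((nontangential_le (lam : ℂ)).trans nhdsWithin_le_nhds)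
  -- Multiply by |1 - w conj λ|² and let w → λ non-tangentially: ‖K_w‖ stays bounded, so ξβ* = 1 and
  -- Cauchy–Schwarz is an equality.
  have hβξ : ξ = β := by
    refine eq_of_mulStar_eq_one hξ.le hβ ?_
    have h1 : Tendsto (fun z => mulStar (B z) β) (nontangential lam) (𝓝 (mulStar ξ β)) :=
      tendsto_mulStar_left hBlim _
    have h2 := (h1.const_sub 1).norm.pow 2
    have h3 := hknorm.mul hden
    rw [mul_zero] at h3
    have h4 : ‖1 - mulStar ξ β‖ ^ 2 ≤ 0 := by
      refine le_of_tendsto_of_tendsto h2 h3 ?_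
      filter_upwards [B.eventually_norm_le_one lam] with w hw
      have h5 := hineq w hw.1
      have h6 : 0 < ‖1 - w * conj (lam : ℂ)‖ := norm_pos_iff.2 (mul_conj_ne_one hn.le hw.1)
      rwa [norm_div, div_pow, div_le_iff₀ (by positivity)] at h5
    have h5 : ‖1 - mulStar ξ β‖ = 0 := by
      nlinarith [norm_nonneg (1 - mulStar ξ β)]
    exact (sub_eq_zero.1 (norm_eq_zero.1 h5)).symm
  rw [← hβξ] at hineq
  -- With β = ξ the same inequality tends to ‖g‖⁴ ≤ ‖g‖² a. If g = 0, the claim is just 0 ≤ a.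
  have hfin : ‖((‖g‖ ^ 2 : ℝ) : ℂ)‖ ^ 2 ≤ ‖g‖ ^ 2 * a :=
    le_of_tendsto_of_tendsto (h.norm.pow 2) hknorm
      ((B.eventually_norm_le_one lam).mono fun w hw => hineq w hw.1)
  rw [Complex.norm_real, Real.norm_of_nonneg (by positivity)] at hfin
  rcases eq_or_lt_of_le (sq_nonneg ‖g‖) with h0 | h0
  · rwa [← h0]
  · exact le_of_mul_le_mul_left (by rwa [← pow_two]) h0

/-- The quotient `(1 - ‖B(z)‖) / (1 - |z|)` has the angular derivative as its lower limit. -/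
lemma IsKernel.liminf_eq {B : SchurFunction D ℂ} {k : ℂ → B.Space}
    (hk : IsKernel B k) {lam : sphere (0 : ℂ) 1} {ξ : D →L[ℂ] ℂ} (hξ : ‖ξ‖ = 1) {g : B.Space}
    (hg : ∀ w ∈ ball (0 : ℂ) 1, g.eval w = (1 - mulStar (B w) ξ) / (1 - w * conj (lam : ℂ)))
    (h : Tendsto (fun z => (1 - mulStar (B z) ξ) / (1 - z * conj (lam : ℂ)))
      (nontangential lam) (𝓝 ((‖g‖ ^ 2 : ℝ) : ℂ))) :
    liminf (fun z : ℂ => (((1 - ‖B z‖) / (1 - ‖z‖) : ℝ) : EReal)) (𝓝[ball (0 : ℂ) 1] (lam : ℂ)) =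
      ((‖g‖ ^ 2 : ℝ) : EReal) := by
  have hn : ‖(lam : ℂ)‖ = 1 := by simp
  refine le_antisymm ?_ ?_
  · have hlim : Tendsto (fun z : ℂ => (1 - ‖B z‖) / (1 - ‖z‖)) (nontangential lam)
        (𝓝 (‖g‖ ^ 2)) := by
      have h1 := (hk.tendsto_boundary_kernel hξ hg h).norm.pow 2
      have h2 : Tendsto (fun z : ℂ => 1 + ‖z‖) (nontangential lam) (𝓝 (1 + 1)) := by
        have h3 : Continuous fun z : ℂ => 1 + ‖z‖ := by fun_prop
        have h4 := (h3.tendsto (lam : ℂ)).mono_left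
          ((nontangential_le (lam : ℂ)).trans nhdsWithin_le_nhds)
        rwa [hn] at h4
      have h3 : Tendsto (fun z : ℂ => 1 + ‖B z‖) (nontangential lam) (𝓝 (1 + 1)) := by
        have := (tendsto_of_caratheodory hξ h).norm.const_add 1
        rwa [hξ] at this
      have h4 := h1.mul (h2.div h3 (by norm_num))
      rw [div_self (by norm_num), mul_one] at h4
      refine h4.congr' ?_
      filter_upwards [B.eventually_norm_le_one lam] with z hz
      have hz1 : ‖z‖ < 1 := mem_ball_zero_iff.1 hz.1
      have hz0 : 1 - ‖z‖ ≠ 0 := by linarith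
      have hz2 : 1 + ‖z‖ ≠ 0 := by positivity
      have hB2 : 1 + ‖B z‖ ≠ 0 := by positivity
      rw [hk.norm_sq hz.1, show 1 - ‖z‖ ^ 2 = (1 - ‖z‖) * (1 + ‖z‖) by ring]
      simp only [Pi.div_apply]
      field_simp
      ring
    rw [← ((continuous_coe_real_ereal.tendsto _).comp hlim).liminf_eq]
    -- The lower limit over the whole disc is at most the one over the finer non-tangential filter.
    exact liminf_le_liminf_of_le (nontangential_le (lam : ℂ))
  · by_contra hlt
    rw [not_le, EReal.lt_iff_exists_real_btwn] at hlt
    obtain ⟨a, ha1, ha2⟩ := hlt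
    have hf := frequently_lt_of_liminf_lt (by isBoundedDefault) ha1
    have := hk.norm_sq_le_of_frequently hξ hg h (hf.mono fun z hz => EReal.coe_lt_coe_iff.1 hz)
    exact absurd (EReal.coe_lt_coe_iff.1 ha2) (not_lt.2 this)

/-- By the maximum principle, Bξ* = 1 at one point makes Bξ* identically 1. Equality in
Cauchy–Schwarz then makes B constantly ξ. -/
lemma SchurFunction.mulStar_ne_one {B : SchurFunction D ℂ}
    (hB : ∃ z ∈ ball (0 : ℂ) 1, ∃ w ∈ ball (0 : ℂ) 1, B z ≠ B w) {ξ : D →L[ℂ] ℂ} (hξ : ‖ξ‖ ≤ 1)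
    {z : ℂ} (hz : z ∈ ball (0 : ℂ) 1) : mulStar (B z) ξ ≠ 1 := by
  intro h1
  have hd : DifferentiableOn ℂ (fun w => mulStar (B w) ξ) (ball 0 1) :=
    B.differentiableOn.clm_apply (differentiableOn_const _)
  have hmax : IsMaxOn (norm ∘ fun w => mulStar (B w) ξ) (ball 0 1) z := by
    intro w hw
    have h2 := norm_mulStar_le (B w) ξ
    have h3 := B.norm_le_one w hw
    change ‖mulStar (B w) ξ‖ ≤ ‖mulStar (B z) ξ‖
    rw [h1, norm_one]
    nlinarith [norm_nonneg (B w), norm_nonneg ξ]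
  have hconst := Complex.eqOn_of_isPreconnected_of_isMaxOn_norm
    (convex_ball (0 : ℂ) 1).isPreconnected isOpen_ball hd hz hmax
  have hall : ∀ w ∈ ball (0 : ℂ) 1, B w = ξ := fun w hw =>
    eq_of_mulStar_eq_one (B.norm_le_one w hw) hξ ((hconst hw).trans h1)
  obtain ⟨u, hu, v, hv, huv⟩ := hB
  exact huv ((hall u hu).trans (hall v hv).symm)

/-- Aleksandrov–Clark measures of nonconstant Schur functions exist. -/
lemma isClarkMeasure_clarkMeasure {B : SchurFunction D ℂ}
    (hB : ∃ z ∈ ball (0 : ℂ) 1, ∃ w ∈ ball (0 : ℂ) 1, B z ≠ B w) {ξ : D →L[ℂ] ℂ}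
    (hξ : ‖ξ‖ ≤ 1) : IsClarkMeasure B ξ (clarkMeasure B ξ) := by
  have hd : DifferentiableOn ℂ (fun w => mulStar (B w) ξ) (ball 0 1) :=
    B.differentiableOn.clm_apply (differentiableOn_const _)
  have hex : ∃ μ, IsClarkMeasure B ξ μ := by
    refine exists_herglotz_measure (H := clarkFunction B ξ) ?_ fun z hz => ?_
    · exact (hd.const_add 1).div (hd.const_sub 1) fun z hz =>
        sub_ne_zero.2 (SchurFunction.mulStar_ne_one hB hξ hz).symm
    · have h1 : ‖mulStar (B z) ξ‖ ≤ 1 := by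
        have h2 := norm_mulStar_le (B z) ξ
        have h3 := B.norm_le_one z hz
        nlinarith [norm_nonneg (B z), norm_nonneg ξ]
      have h2 : Complex.normSq (mulStar (B z) ξ) ≤ 1 := by
        rw [Complex.normSq_eq_norm_sq]
        nlinarith [norm_nonneg (mulStar (B z) ξ)]
      rw [Complex.normSq_apply] at h2
      rw [clarkFunction, Complex.div_re, ← add_div]
      refine div_nonneg ?_ (Complex.normSq_nonneg _)
      simp only [Complex.add_re, Complex.sub_re, Complex.add_im, Complex.sub_im, Complex.one_re,
        Complex.one_im]
      nlinarith
  rw [clarkMeasure, dif_pos hex]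
  exact hex.choose_spec

/-- Along z = rλ the denominator 1 - z conj λ is 1 - r, so (1 - r) H_ξ times the Carathéodory
quotient is 1 + Bξ*. In the limit this reads 2 μ_ξ({λ}) c = 2. -/
lemma clarkMeasure_real_mul {B : SchurFunction D ℂ}
    (hB : ∃ z ∈ ball (0 : ℂ) 1, ∃ w ∈ ball (0 : ℂ) 1, B z ≠ B w) {lam : sphere (0 : ℂ) 1}
    {ξ : D →L[ℂ] ℂ} (hξ : ‖ξ‖ ≤ 1) {c : ℝ}
    (h : Tendsto (fun z => (1 - mulStar (B z) ξ) / (1 - z * conj (lam : ℂ)))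
      (nontangential lam) (𝓝 (c : ℂ))) : (clarkMeasure B ξ).real {lam} * c = 1 := by
  obtain ⟨hfin, hrep⟩ := isClarkMeasure_clarkMeasure hB hξ
  have hn : (lam : ℂ) * conj (lam : ℂ) = 1 := by
    rw [Complex.mul_conj, Complex.normSq_eq_norm_sq]; simp
  have hrad := tendsto_radial lam
  have hr0 : Tendsto (fun r : ℝ => ((1 - r : ℝ) : ℂ)) (𝓝[<] 1) (𝓝 0) := by
    have h1 : Continuous fun r : ℝ => ((1 - r : ℝ) : ℂ) := by fun_prop
    simpa using (h1.tendsto 1).mono_left nhdsWithin_le_nhds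
  have h1 := ((tendsto_mul_herglotz_integral (clarkMeasure B ξ) lam).add
    (hr0.mul_const (Complex.I * ((clarkFunction B ξ 0).im : ℂ)))).mul (h.comp hrad)
  have h2 := ((tendsto_mulStar_of_caratheodory h).comp hrad).const_add 1
  have h3 := tendsto_nhds_unique h1 (h2.congr' ?_)
  · rw [zero_mul, add_zero] at h3
    have h4 : 2 * (clarkMeasure B ξ).real {lam} * c = 1 + 1 := by exact_mod_cast h3
    linarith
  · filter_upwards [Ioo_mem_nhdsLT (zero_lt_one (α := ℝ)),
      hrad.eventually (B.eventually_norm_le_one lam)] with r hr hb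
    have hne : (1 : ℂ) - mulStar (B (r * lam)) ξ ≠ 0 :=
      sub_ne_zero.2 (SchurFunction.mulStar_ne_one hB hξ hb.1).symm
    have hr1 : ((1 - r : ℝ) : ℂ) ≠ 0 := by
      rw [Complex.ofReal_ne_zero]
      linarith [hr.2]
    have hu : 1 - (r : ℂ) * lam * conj (lam : ℂ) = ((1 - r : ℝ) : ℂ) := by
      rw [mul_assoc, hn]
      push_cast
      ring
    rw [← mul_add, ← hrep _ hb.1, clarkFunction]
    simp only [Function.comp_apply, hu]
    field_simp

end Caratheodory

end DeBrangesRovnyak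

theorem mainTheorem6 {D : Type*} [NormedAddCommGroup D] [InnerProductSpace ℂ D] [CompleteSpace D]
    [TopologicalSpace.SeparableSpace D] (B : DeBrangesRovnyak.SchurFunction D ℂ)
    (lam : sphere (0 : ℂ) 1) (hB : DeBrangesRovnyak.SatisfiesCaratheodory B lam) :
    -- `Blam` is the non-tangential limit `B(λ)`
    ∃ Blam : D →L[ℂ] ℂ,
      Tendsto (fun z => B z) (DeBrangesRovnyak.nontangential lam) (𝓝 Blam) ∧
      -- the kernels lie in `H(B)` and converge in norm
      (∃ (K : ℂ → B.Space) (Klam : B.Space),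
        (∀ z ∈ ball (0 : ℂ) 1, ∀ w ∈ ball (0 : ℂ) 1,
          (K z).eval w = (1 - DeBrangesRovnyak.mulStar (B w) (B z)) / (1 - w * conj z)) ∧
        (∀ w ∈ ball (0 : ℂ) 1,
          Klam.eval w = (1 - DeBrangesRovnyak.mulStar (B w) Blam) / (1 - w * conj (lam : ℂ))) ∧
        Tendsto K (DeBrangesRovnyak.nontangential lam) (𝓝 Klam)) ∧
      ∃ c : ℝ,
        liminf (fun z : ℂ => (((1 - ‖B z‖) / (1 - ‖z‖) : ℝ) : EReal))
          (𝓝[ball (0 : ℂ) 1] (lam : ℂ)) = (c : EReal) ∧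
        Tendsto (fun z => (1 - DeBrangesRovnyak.mulStar (B z) Blam) / (1 - z * conj (lam : ℂ)))
          (DeBrangesRovnyak.nontangential lam) (𝓝 (c : ℂ)) ∧
        -- `B` constant is excluded here, since the Clark measure is then undefined
        ((∃ z ∈ ball (0 : ℂ) 1, ∃ w ∈ ball (0 : ℂ) 1, B z ≠ B w) →
          0 < (DeBrangesRovnyak.clarkMeasure B Blam).real {lam} ∧
          c = 1 / (DeBrangesRovnyak.clarkMeasure B Blam).real {lam}) := by
  open DeBrangesRovnyak in
  obtain ⟨ξ, hξ, l, hl⟩ := hB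
  simp_rw [← div_eq_mul_inv] at hl
  obtain ⟨g, hg, rfl⟩ := exists_boundary_kernel hξ hl
  obtain ⟨k, hk⟩ := exists_isKernel B
  refine ⟨ξ, tendsto_of_caratheodory hξ hl,
    ⟨k, g, fun z hz => (hk z hz).1, hg, hk.tendsto_boundary_kernel hξ hg hl⟩, ‖g‖ ^ 2,
    hk.liminf_eq hξ hg hl, hl, fun hne => ?_⟩
  have h1 := clarkMeasure_real_mul hne hξ.le hl
  have h2 : 0 < (clarkMeasure B ξ).real {lam} := by
    refine lt_of_le_of_ne measureReal_nonneg fun h => ?_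
    rw [← h, zero_mul] at h1
    exact zero_ne_one h1
  exact ⟨h2, by rw [eq_div_iff h2.ne', mul_comm, h1]⟩
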